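/- \textbf{Ensemble.} Let $\lambda(x)=\sum_i\lambda_i x^{i-1}$ and $\rho(x)=\sum_i\rho_i x^{i-1}$ be degree distributions from the edge perspective with finite support in $i\ge 1$ ($\lambda_i,\rho_i\ge 0$, $\lambda(1)=\rho(1)=1$), let $L_i=(\lambda_i/i)/\sum_j(\lambda_j/j)$ and $R_i=(\rho_i/i)/\sum_j(\rho_j/j)$ be the corresponding node fractions, and let $L(x)=\sum_i L_ix^i$. Consider blocklengths $n\to\infty$ and, for each $n$, degrees of $n$ variable nodes and of some number of check nodes with equal total degrees, bounded uniformly in $n$, such that the fractions of variable nodes and of check nodes of degree $i$ tend to $L_i$ and $R_i$ for every $i$ (in particular, they may be equal to $L_i$ and $R_i$). The random graph $\mathcal G\in\mathrm{LDPC}(\lambda,\rho)$ is obtained by matching the half-edges of the variable nodes with those of the check nodes by a uniform random permutation and then permuting the $n$ variable nodes uniformly at random. Let $\mathcal C=\{{\bf x}\in\mathbb F_2^n:{\bf H}{\bf x}={\bf 0}\}$, where ${\bf H}$ is the parity check matrix of $\mathcal G$, and let ${\bf d}$ be uniform on $\mathbb F_2^n$ and independent of $\mathcal G$. \textbf{Channel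 and decoder.} User $u\in\{1,2\}$ sends ${\bf m}_u={\bf c}_u+{\bf d}$ with ${\bf c}_u\in\mathcal C$ (both users have the same code and the same dither) in the form $s_{u,i}=2m_{u,i}-1$ for $1\le i\le n$, and $s_{u,i}=0$ for all other $i$. The receiver observes $y_i=s_{1,i}+s_{2,i-\tau}$, $1\le i\le n+\tau$, with a known delay $\tau$, and runs belief propagation on the joint graph, which consists of two copies of $\mathcal G$, one for each user, and of MAC nodes that join bit $i$ of user 1 to bit $i-\tau$ of user 2. Initially only the channel outputs are known. In each iteration, the variable nodes send messages to the check nodes and the check nodes send messages back, in both copies; the value of a bit after the iteration combines all the messages that its check nodes sent in this iteration with the MAC message available in it; then the variable nodes send the combination of their check node messages to the MAC nodes, whose replies are used in the next iteration. A variable node message is erased if all the other incoming messages are erased, a check node message is erased if one of the other incoming messages is erased, and a MAC node message is erased if $y_i=0$ and the message from the other user's bit is erased. Let $P_b({\bf d},{\bf c},l)$ be the fraction of the $2n$ bits that are erased after $l$ iterations, and let $$\bar P_b({\bf d},l)=\frac1{|\mathcal C|^2}\sum_{{\bf c}_1,{\bf c}_2\in\mathcal C}P_b({\bf d},({\bf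 c}_1,{\bf c}_2),l).$$ \textbf{Density evolution.} Let $y_0=1$, $z_0=\tfrac12$ and, for $l\ge 0$, $$x_{l+1}=z_l\lambda(y_l),\quad y_{l+1}=1-\rho(1-x_{l+1}),\quad z_{l+1}=\tfrac12L(y_{l+1}),\quad p_{l+1}=z_lL(y_{l+1}),$$ so that $x_{l+1}=\tfrac12L\bigl(1-\rho(1-x_l)\bigr)\lambda\bigl(1-\rho(1-x_l)\bigr)$ for $l\ge 1$. \textbf{Theorem.} Let $\tau_{\max}=\tau_{\max}(n)$ be such that $\tau_{\max}/n\to 0$ as $n\to\infty$. Then, for every $l\ge 1$ and every $\varepsilon>0$, $$\mathbb P_{\mathcal G,{\bf d}}\bigl(|\bar P_b({\bf d},l)-p_l|>\varepsilon\bigr)\to 0\qquad\text{as }n\to\infty,$$ uniformly over all $\tau\in[1:\tau_{\max}]$. -/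

import Mathlib

open Filter Topology

noncomputable section

/-! ### Degree distributions and density evolution -/

/-- An edge-perspective degree distribution with finite support: `frac i` is the fraction of edges
that are attached to nodes of degree `i`. -/
structure EdgeDist where
  frac : ℕ →₀ ℝ
  nonneg : ∀ i, 0 ≤ frac i
  frac_zero : frac 0 = 0
  sum_eq_one : ∑ i ∈ frac.support, frac i = 1

namespace EdgeDist

/-- The edge-perspective polynomial `∑ frac i * x ^ (i - 1)`. -/
def edgePoly (a : EdgeDist) (x : ℝ) : ℝ :=
  ∑ i ∈ a.frac.support, a.frac i * x ^ (i - 1)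

/-- The fraction of nodes that have degree `i`: proportional to `frac i / i`. -/
def nodeFrac (a : EdgeDist) (i : ℕ) : ℝ :=
  (a.frac i / i) / ∑ j ∈ a.frac.support, a.frac j / j

/-- The node-perspective polynomial `∑ nodeFrac i * x ^ i`. -/
def nodePoly (a : EdgeDist) (x : ℝ) : ℝ :=
  ∑ i ∈ a.frac.support, a.nodeFrac i * x ^ i

end EdgeDist

/-- The erasure probabilities tracked by density evolution: `x` variable node to check node,
`y` check node to variable node, `w` variable node to MAC node, `z` MAC node to variable node. -/
structure DEState where
  x : ℝ
  y : ℝ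
  w : ℝ
  z : ℝ

/-- Density evolution for the variable node distribution `lam` and check node distribution `rho`.
Before the first iteration nothing has been sent by the variable nodes, and half of the channel
outputs are erasures. -/
def deState (lam rho : EdgeDist) : ℕ → DEState
  | 0 => ⟨1, 1, 1, 1 / 2⟩
  | l + 1 =>
    let s := deState lam rho l
    let x := s.z * lam.edgePoly s.y
    let y := 1 - rho.edgePoly (1 - x)
    let w := lam.nodePoly y
    ⟨x, y, w, 1 / 2 * w⟩

/-- The density evolution prediction `p l` of the bit erasure rate after `l` iterations. (The value
at `l = 0` is the fraction of erased channel outputs.) -/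
def deBER (lam rho : EdgeDist) : ℕ → ℝ
  | 0 => 1 / 2
  | l + 1 => (deState lam rho l).z * lam.nodePoly (deState lam rho (l + 1)).y

/-- The scalar form of the recursion. -/
theorem deState_x_succ (lam rho : EdgeDist) (l : ℕ) (hl : 1 ≤ l) :
    (deState lam rho (l + 1)).x =
      1 / 2 * lam.nodePoly (1 - rho.edgePoly (1 - (deState lam rho l).x)) *
        lam.edgePoly (1 - rho.edgePoly (1 - (deState lam rho l).x)) := by
  obtain ⟨k, rfl⟩ : ∃ k, l = k + 1 := ⟨l - 1, by omega⟩
  rfl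

/-! ### Tanner graphs and their codes -/

/-- A bipartite multigraph with `n` variable nodes, `m` check nodes and edge set `E`. -/
structure TannerGraph (n m : ℕ) (E : Type) where
  vn : E → Fin n
  cn : E → Fin m

/-- The parity check matrix: multiplicities of the edges, modulo two. -/
def TannerGraph.H {n m : ℕ} {E : Type} [Fintype E] (G : TannerGraph n m E) :
    Matrix (Fin m) (Fin n) (ZMod 2) :=
  fun c v => ((Finset.univ.filter fun e => G.cn e = c ∧ G.vn e = v).card : ZMod 2)

/-- The linear code of the graph. -/
def TannerGraph.code {n m : ℕ} {E : Type} [Fintype E] (G : TannerGraph n m E) :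
    Finset (Fin n → ZMod 2) :=
  Finset.univ.filter fun x => G.H.mulVec x = 0

/-! ### The two-user frame-asynchronous binary adder channel

Users are indexed by `Fin 2` and `u + 1` is the other user. Time and code positions are counted
from `0`, and bit `i` of user `u` is sent at time `i + delay τ u`. -/

/-- BPSK: `b ↦ 2 b - 1`. -/
def bpsk (b : ZMod 2) : ℤ := if b = 1 then 1 else -1

/-- User `0` is not delayed, user `1` is delayed by `τ`. -/
def delay (τ : ℕ) (u : Fin 2) : ℕ := if u = 0 then 0 else τ

/-- The frame `f` delayed by `s`, as a function of time, with value `dflt` outside the frame. -/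
def delayed {n : ℕ} {α : Type} (dflt : α) (s : ℕ) (f : Fin n → α) (t : ℕ) : α :=
  if h : s ≤ t ∧ t - s < n then f ⟨t - s, h.2⟩ else dflt

/-- The channel output at time `t` when user `u` sends the binary word `b u`. -/
def channelOut {n : ℕ} (τ : ℕ) (b : Fin 2 → Fin n → ZMod 2) (t : ℕ) : ℤ :=
  ∑ u : Fin 2, delayed 0 (delay τ u) (fun i => bpsk (b u i)) t

/-! ### Belief propagation on the joint graph -/

/-- A message is a bit or the erasure symbol `none`. -/
abbrev Msg := Option (ZMod 2)

/-- The message that a MAC node with channel output `y` sends to one of its variable nodes, given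
the message `w` from its other variable node (`none` if there is no other one). -/
def macRule (y : ℤ) (w : Msg) : Msg :=
  if 0 < y then some 1 else if y < 0 then some 0 else w.map (fun b => b + 1)

open Classical in
/-- Combination of incoming messages at a variable node: the value of the incoming messages that
are not erased, and an erasure if all of them are erased. -/
def vnRule (S : Set Msg) : Msg :=
  if some 0 ∈ S then some 0 else if some 1 ∈ S then some 1 else none

open Classical in
/-- The message from a check node with parity `s`, given the messages `q e`, `e ∈ S`, on its other
edges. -/
def cnRule {E : Type} (s : ZMod 2) (S : Finset E) (q : E → Msg) : Msg :=
  if ∀ e ∈ S, q e ≠ none then some (s + ∑ e ∈ S, (q e).getD 0) else none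

section BP

variable {n m : ℕ} {E : Type} [Fintype E] [DecidableEq E]

/-- The messages at the end of an iteration: from check nodes along the edges to variable nodes, and
from variable nodes to MAC nodes, in the graphs of both users. -/
structure BPState (n : ℕ) (E : Type) where
  cv : Fin 2 → E → Msg
  vm : Fin 2 → Fin n → Msg

/-- The message from the MAC node to variable node `i` of user `u`, in state `S`, for delay `τ` and
channel output `y`. -/
def macMsg (τ : ℕ) (y : ℕ → ℤ) (S : BPState n E) (u : Fin 2) (i : Fin n) : Msg :=
  macRule (y (i + delay τ u)) (delayed none (delay τ (u + 1)) (S.vm (u + 1)) (i + delay τ u))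

/-- The message from a variable node to a check node along the edge `e` in the graph of user `u`. -/
def vcMsg (G : TannerGraph n m E) (τ : ℕ) (y : ℕ → ℤ) (S : BPState n E) (u : Fin 2) (e : E) : Msg :=
  vnRule ({macMsg τ y S u (G.vn e)} ∪ {a | ∃ e', e' ≠ e ∧ G.vn e' = G.vn e ∧ a = S.cv u e'})

/-- The message from a check node to a variable node along the edge `e` in the graph of user `u`,
computed from the current messages `vcMsg`; `s` is the vector of parities. -/
def cvMsg (G : TannerGraph n m E) (s : Fin m → ZMod 2) (τ : ℕ) (y : ℕ → ℤ) (S : BPState n E)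
    (u : Fin 2) (e : E) : Msg :=
  cnRule (s (G.cn e)) (Finset.univ.filter fun e' => e' ≠ e ∧ G.cn e' = G.cn e)
    (vcMsg G τ y S u)

/-- The state after `l` iterations. In an iteration each of the two single-user decoders performs
one iteration, and then the variable nodes send messages to the MAC nodes. -/
def bpState (G : TannerGraph n m E) (s : Fin m → ZMod 2) (τ : ℕ) (y : ℕ → ℤ) : ℕ → BPState n E
  | 0 => ⟨fun _ _ => none, fun _ _ => none⟩
  | l + 1 =>
    let cv := cvMsg G s τ y (bpState G s τ y l)
    ⟨cv, fun u i => vnRule {a | ∃ e, G.vn e = i ∧ a = cv u e}⟩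

/-- The value of variable node `i` of user `u` after `l` iterations: it combines the messages of
all its check nodes in iteration `l` with the MAC message that was available in that iteration. -/
def vnValue (G : TannerGraph n m E) (s : Fin m → ZMod 2) (τ : ℕ) (y : ℕ → ℤ) :
    ℕ → Fin 2 → Fin n → Msg
  | 0, u, i => macMsg τ y (bpState G s τ y 0) u i
  | l + 1, u, i =>
    vnRule ({macMsg τ y (bpState G s τ y l) u i} ∪
      {a | ∃ e, G.vn e = i ∧ a = (bpState G s τ y (l + 1)).cv u e})

/-- The fraction of the `2 n` variable nodes that are erased after `l` iterations, when the users
send `c u + d` for the pair `c` of words of the linear code and the dither `d`. The decoder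
knows the graph, the delay and the dither, hence the parities `H d` that the transmitted words
satisfy. -/
def ber (G : TannerGraph n m E) (d : Fin n → ZMod 2) (τ : ℕ) (c : Fin 2 → Fin n → ZMod 2)
    (l : ℕ) : ℝ :=
  ((Finset.univ.filter fun p : Fin 2 × Fin n =>
    vnValue G (G.H.mulVec d) τ (channelOut τ (fun u => c u + d)) l p.1 p.2 = none).card : ℝ) /
      (2 * n)

/-- The bit erasure rate averaged over all pairs of codewords. -/
def avgBER (G : TannerGraph n m E) (d : Fin n → ZMod 2) (τ l : ℕ) : ℝ :=
  1 / (G.code.card : ℝ) ^ 2 * ∑ c₁ ∈ G.code, ∑ c₂ ∈ G.code, ber G d τ ![c₁, c₂] l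

end BP

/-! ### The random ensemble -/

/-- Degrees of the `n` variable nodes and of `m` check nodes with equal numbers of half-edges. -/
structure DegreeAssignment (n : ℕ) where
  m : ℕ
  dv : Fin n → ℕ
  dc : Fin m → ℕ
  sum_eq : ∑ i, dv i = ∑ j, dc j

namespace DegreeAssignment

variable {n : ℕ}

/-- Half-edges at the variable nodes. They also serve as names of the edges. -/
abbrev VStub (a : DegreeAssignment n) : Type := Σ i : Fin n, Fin (a.dv i)

/-- Half-edges at the check nodes. -/
abbrev CStub (a : DegreeAssignment n) : Type := Σ j : Fin a.m, Fin (a.dc j)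

/-- The randomness of the ensemble: the matching of the half-edges, the permutation of the variable
nodes, and the dither. -/
abbrev Sample (a : DegreeAssignment n) : Type :=
  (a.VStub ≃ a.CStub) × Equiv.Perm (Fin n) × (Fin n → ZMod 2)

/-- The graph given by a matching `π` of the half-edges and a permutation `σ` of the variable
nodes. -/
def graph (a : DegreeAssignment n) (π : a.VStub ≃ a.CStub) (σ : Equiv.Perm (Fin n)) :
    TannerGraph n a.m a.VStub where
  vn e := σ e.1
  cn e := (π e).1

/-- Probability of an event when matching, permutation and dither are independent and uniformly
distributed. -/
def prob (a : DegreeAssignment n) (A : Set a.Sample) : ℝ :=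
  (A.ncard : ℝ) / (Nat.card a.Sample : ℝ)

end DegreeAssignment

/-- `deg k`, `k = 0, 1, …`, are degree assignments for the ensemble LDPC(`lam`, `rho`) with
blocklengths `n k → ∞`: the degrees are bounded and the fractions of variable and check nodes of
each degree converge to those of `lam` and `rho`. (If the prescribed numbers of nodes of each degree
are integers, the fractions may be equal to the limits; in general they have to be rounded.) -/
structure IsLDPCSequence (lam rho : EdgeDist) (n : ℕ → ℕ)
    (deg : ∀ k, DegreeAssignment (n k)) : Prop where
  blocklength : Tendsto n atTop atTop
  bounded : ∃ D : ℕ, ∀ k, (∀ i, (deg k).dv i ≤ D) ∧ ∀ j, (deg k).dc j ≤ D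
  vn_frac : ∀ i : ℕ, Tendsto
    (fun k => ((Finset.univ.filter fun v => (deg k).dv v = i).card : ℝ) / (n k : ℝ))
    atTop (𝓝 (lam.nodeFrac i))
  cn_frac : ∀ i : ℕ, Tendsto
    (fun k => ((Finset.univ.filter fun c => (deg k).dc c = i).card : ℝ) / ((deg k).m : ℝ))
    atTop (𝓝 (rho.nodeFrac i))

end

/-! Whether a message is erased depends only on the graph and on which channel outputs vanish in the
overlap, not on the values that are sent. For fixed codewords, output `t` vanishes there exactly
when `c₁(t) + d(t) + c₂(t - τ) + d(t - τ) = 1`. Completed by the bits of user 0 in the first `τ`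
positions, this pattern is a triangular affine function of the dither because `τ ≥ 1`. So for each
pair of codewords it is uniform and independent of the graph (`erasurePattern_bijective`). By
convexity of the square, the mean square deviation of the codeword average is at most that of the
erased fraction under a uniform pattern (`finMean_avgBER_sub_sq_le`), and Chebyshev's inequality
reduces the theorem to a second moment bound.

The erasure of a node after `l` iterations is decided by revealing boundedly many values: mates of
half-edges, positions of nodes, bits of the pattern. Given what is known, each new value is uniform
over the answers still possible. Outside a small fraction of bad answers it leads to an untouched
object. Although both users share one graph, the random permutation together with the shift makes
the MAC partner of a node an almost uniform fresh node, so the explored part of the joint graph is a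
tree without repeated nodes. Along this tree erasure probabilities multiply as in density evolution.
Two distinct nodes can be explored in succession, so their erasures are almost uncorrelated
(`finMean_erasureDev_mul_le`).

Independence up to errors is encoded by `Explores`: a lower bound for the mean of every nonnegative
function in terms of its conditional means after the exploration. Nonnegativity allows bad answers
to be dropped, so no bound on collision events is needed, and lower bounds alone suffice to bound
correlations from above. The recursion obtained is density evolution for the degrees of the finite
graph (`deY`, `deBit`); bounded degrees and convergence of the degree fractions give its limit. -/

open Filter Topology

/-! ### Averages over finite sets and symmetric queries -/

/-- The average of `F` over the finite set `A`. -/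
noncomputable def finMean {Ω : Type*} (F : Ω → ℝ) (A : Finset Ω) : ℝ :=
  (∑ ω ∈ A, F ω) / A.card

/-- On the set `A`, the random variable `q` takes values in `B`, and any two values in `B` can be
exchanged by an injection of the sample space. -/
def IsSymmQuery {Ω β : Type*} (A : Finset Ω) (q : Ω → β) (B : Finset β) : Prop :=
  (∀ ω ∈ A, q ω ∈ B) ∧ ∀ b ∈ B, ∀ b' ∈ B, ∃ φ : Ω → Ω, Function.Injective φ ∧
    ∀ ω ∈ A, q ω = b → φ ω ∈ A ∧ q (φ ω) = b'

section Query

variable {Ω β : Type*} [DecidableEq β] {A : Finset Ω} {q : Ω → β} {B : Finset β}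

theorem finMean_nonneg {F : Ω → ℝ} (hF : ∀ ω, 0 ≤ F ω) (A : Finset Ω) : 0 ≤ finMean F A :=
  div_nonneg (Finset.sum_nonneg fun _ _ => hF _) (Nat.cast_nonneg _)

theorem finMean_eq_of_forall {F : Ω → ℝ} {A : Finset Ω} (hA : A.Nonempty) {c : ℝ}
    (h : ∀ ω ∈ A, F ω = c) : finMean F A = c := by
  have : (A.card : ℝ) ≠ 0 := by exact_mod_cast hA.card_pos.ne'
  rw [finMean, Finset.sum_congr rfl h, Finset.sum_const, nsmul_eq_mul, mul_div_cancel_left₀ _ this]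

theorem IsSymmQuery.nonempty (h : IsSymmQuery A q B) (hA : A.Nonempty) {b : β} (hb : b ∈ B) :
    (A.filter fun ω => q ω = b).Nonempty := by
  obtain ⟨ω, hω⟩ := hA
  obtain ⟨φ, -, hφ⟩ := h.2 _ (h.1 ω hω) b hb
  exact ⟨φ ω, Finset.mem_filter.2 (hφ ω hω rfl)⟩

theorem IsSymmQuery.card_le (h : IsSymmQuery A q B) {b b' : β} (hb : b ∈ B) (hb' : b' ∈ B) :
    (A.filter fun ω => q ω = b).card ≤ (A.filter fun ω => q ω = b').card := by
  obtain ⟨φ, hinj, hφ⟩ := h.2 b hb b' hb'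
  refine Finset.card_le_card_of_injOn φ (fun ω hω => ?_) hinj.injOn
  have := Finset.mem_filter.1 hω
  exact Finset.mem_coe.2 (Finset.mem_filter.2 (hφ ω this.1 this.2))

/-- The exchange injections make all fibres over `B` equally large, so the mean over `A` is the
uniform average over `B` of the conditional means. Answers outside `G` are dropped and the
denominator is enlarged to all of `β`, which only lowers the bound for a nonnegative function. With
this denominator the averages are exactly those in `vnNode`, `vnEdge` and `deY`. -/
theorem IsSymmQuery.le_finMean [Fintype β] (h : IsSymmQuery A q B) {F : Ω → ℝ}
    (hF : ∀ ω, 0 ≤ F ω) {G : Finset β} (hG : G ⊆ B) :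
    (∑ b ∈ G, finMean F (A.filter fun ω => q ω = b)) / Fintype.card β ≤ finMean F A := by
  rcases A.eq_empty_or_nonempty with rfl | hA
  · simp [finMean]
  obtain ⟨ω₀, hω₀⟩ := hA
  set b₀ := q ω₀
  have hb₀ : b₀ ∈ B := h.1 ω₀ hω₀
  set k := (A.filter fun ω => q ω = b₀).card
  have hk : ∀ b ∈ B, (A.filter fun ω => q ω = b).card = k := fun b hb =>
    le_antisymm (h.card_le hb hb₀) (h.card_le hb₀ hb)
  have hk0 : 0 < k := (h.nonempty ⟨ω₀, hω₀⟩ hb₀).card_pos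
  have hcard : A.card = B.card * k := by
    rw [Finset.card_eq_sum_card_fiberwise (f := q) (t := B) (fun ω hω => h.1 ω hω),
      Finset.sum_congr rfl hk, Finset.sum_const, smul_eq_mul]
  have hB0 : 0 < B.card := Finset.card_pos.2 ⟨_, hb₀⟩
  have hsum : ∑ ω ∈ A, F ω = ∑ b ∈ B, ∑ ω ∈ A with q ω = b, F ω :=
    (Finset.sum_fiberwise_of_maps_to (fun ω hω => h.1 ω hω) F).symm
  have hmean : finMean F A = (∑ b ∈ B, finMean F (A.filter fun ω => q ω = b)) / B.card := by
    have : ∀ b ∈ B, finMean F (A.filter fun ω => q ω = b)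
        = (∑ ω ∈ A with q ω = b, F ω) / k := fun b hb => by rw [finMean, hk b hb]
    rw [Finset.sum_congr rfl this, ← Finset.sum_div, ← hsum, finMean, hcard, div_div, mul_comm]
    push_cast; ring
  rw [hmean]
  have h1 : ∑ b ∈ G, finMean F (A.filter fun ω => q ω = b)
      ≤ ∑ b ∈ B, finMean F (A.filter fun ω => q ω = b) :=
    Finset.sum_le_sum_of_subset_of_nonneg hG fun _ _ _ => finMean_nonneg hF _
  have h2 : (B.card : ℝ) ≤ Fintype.card β := by exact_mod_cast Finset.card_le_univ B
  have h3 : (0 : ℝ) < B.card := by exact_mod_cast hB0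
  have h4 : 0 ≤ ∑ b ∈ B, finMean F (A.filter fun ω => q ω = b) :=
    Finset.sum_nonneg fun _ _ => finMean_nonneg hF _
  exact div_le_div₀ h4 h1 h3 h2

end Query

/-! ### Partially revealed samples -/

namespace DegreeAssignment

variable {n : ℕ}

/-- Partial information on a sample: some values of the matching, of the permutation and of the
binary word, together with finite sets of variable nodes, check nodes and positions that count as
touched. -/
structure Known (a : DegreeAssignment n) where
  pairs : Finset (a.VStub × a.CStub)
  labels : Finset (Fin n × Fin n)
  bits : Finset (Fin n × ZMod 2)
  vns : Finset (Fin n)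
  cns : Finset (Fin a.m)
  pos : Finset (Fin n)

/-- Quantities that can be revealed: the mate of a half-edge, or the position of a node. -/
inductive Item (a : DegreeAssignment n) : Type
  | vstub (s : a.VStub) : Item a
  | cstub (b : a.CStub) : Item a
  | label (v : Fin n) : Item a

variable {a : DegreeAssignment n}

namespace Known

open Classical in
/-- The samples that are compatible with the revealed values. -/
noncomputable def event (S : Known a) : Finset a.Sample :=
  Finset.univ.filter fun ω => (∀ x ∈ S.pairs, ω.1 x.1 = x.2) ∧
    (∀ x ∈ S.labels, ω.2.1 x.1 = x.2) ∧ ∀ x ∈ S.bits, ω.2.2 x.1 = x.2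

theorem mem_event {S : Known a} {ω : a.Sample} : ω ∈ S.event ↔ (∀ x ∈ S.pairs, ω.1 x.1 = x.2) ∧
    (∀ x ∈ S.labels, ω.2.1 x.1 = x.2) ∧ ∀ x ∈ S.bits, ω.2.2 x.1 = x.2 := by
  simp [event]

/-- The item has been revealed. -/
def Used (S : Known a) : Item a → Prop
  | .vstub s => ∃ x ∈ S.pairs, x.1 = s
  | .cstub b => ∃ x ∈ S.pairs, x.2 = b
  | .label v => ∃ x ∈ S.labels, x.1 = v

/-- The node of the item has been touched. -/
def Touched (S : Known a) : Item a → Prop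
  | .vstub s => s.1 ∈ S.vns
  | .cstub b => b.1 ∈ S.cns
  | .label v => v ∈ S.vns

/-- The number of touched objects. -/
def size (S : Known a) : ℕ := S.vns.card + S.cns.card + S.pos.card

/-- The information is consistent, and everything that has been revealed is touched. -/
structure Good (S : Known a) : Prop where
  nonempty : S.event.Nonempty
  pairs_touched : ∀ x ∈ S.pairs, x.1.1 ∈ S.vns ∧ x.2.1 ∈ S.cns
  labels_touched : ∀ x ∈ S.labels, x.1 ∈ S.vns ∧ x.2 ∈ S.pos
  bits_touched : ∀ x ∈ S.bits, x.1 ∈ S.pos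

/-- `S'` extends `S` by at most `κ` touched objects; among the items whose node is touched in `S`,
only those in `A` may have been revealed in addition. -/
structure Ext (A : Set (Item a)) (κ : ℕ) (S S' : Known a) : Prop where
  good : S'.Good
  event_subset : S'.event ⊆ S.event
  vns_subset : S.vns ⊆ S'.vns
  cns_subset : S.cns ⊆ S'.cns
  frame : ∀ x, S'.Used x → S.Used x ∨ ¬ S.Touched x ∨ x ∈ A
  size_le : S'.size ≤ S.size + κ

theorem Ext.refl {S : Known a} (hS : S.Good) : Ext ∅ 0 S S :=
  ⟨hS, subset_rfl, subset_rfl, subset_rfl, fun _ h => Or.inl h, le_rfl⟩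

theorem Ext.touched {A : Set (Item a)} {κ : ℕ} {S S' : Known a} (h : Ext A κ S S') {x : Item a}
    (hx : S.Touched x) : S'.Touched x := by
  cases x with
  | vstub s => exact h.vns_subset hx
  | cstub b => exact h.cns_subset hx
  | label v => exact h.vns_subset hx

theorem Ext.not_used {A : Set (Item a)} {κ : ℕ} {S S' : Known a} (h : Ext A κ S S') {x : Item a}
    (ht : S.Touched x) (hu : ¬ S.Used x) (hA : x ∉ A) : ¬ S'.Used x := fun hx => by
  rcases h.frame x hx with h | h | h <;> contradiction

/-- Touched sets only grow, so an item that is new to the second stage was also new to the first. It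
need not be listed in the union. -/
theorem Ext.trans {A A' : Set (Item a)} {κ κ' : ℕ} {S S' S'' : Known a} (h : Ext A κ S S')
    (h' : Ext A' κ' S' S'') : Ext (A ∪ A') (κ + κ') S S'' := by
  refine ⟨h'.good, h'.event_subset.trans h.event_subset, h.vns_subset.trans h'.vns_subset,
    h.cns_subset.trans h'.cns_subset, fun x hx => ?_, ?_⟩
  · rcases h'.frame x hx with h1 | h1 | h1
    · rcases h.frame x h1 with h2 | h2 | h2
      · exact Or.inl h2
      · exact Or.inr (Or.inl h2)
      · exact Or.inr (Or.inr (Or.inl h2))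
    · exact Or.inr (Or.inl fun h2 => h1 (h.touched h2))
    · exact Or.inr (Or.inr (Or.inr h1))
  · have := h.size_le
    have := h'.size_le
    omega

theorem Ext.mono {A A' : Set (Item a)} {κ κ' : ℕ} {S S' : Known a} (h : Ext A κ S S')
    (hA : ∀ x ∈ A, x ∈ A' ∨ ¬ S.Touched x) (hκ : κ ≤ κ') : Ext A' κ' S S' := by
  refine ⟨h.good, h.event_subset, h.vns_subset, h.cns_subset, fun x hx => ?_,
    h.size_le.trans (by omega)⟩
  rcases h.frame x hx with h1 | h1 | h1
  · exact Or.inl h1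
  · exact Or.inr (Or.inl h1)
  · rcases hA x h1 with h2 | h2
    · exact Or.inr (Or.inr h2)
    · exact Or.inr (Or.inl h2)

/-- Starting from the information `S`, the truth value of `P` can be found out by revealing only
those touched items that are in `A`, at cost `κ`, and up to an error `κ * η` it is true with
probability `q`. This is expressed by a lower bound on all conditional means. -/
def Explores (η : ℝ) (S : Known a) (A : Set (Item a)) (κ : ℕ) (P : a.Sample → Prop) (q : ℝ) :
    Prop :=
  ∀ F : a.Sample → ℝ, (∀ ω, 0 ≤ F ω) → ∀ g₁ g₀ : ℝ, g₁ ≤ 1 → g₀ ≤ 1 →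
    (∀ S', Ext A κ S S' → (∀ ω ∈ S'.event, P ω) → g₁ ≤ finMean F S'.event) →
    (∀ S', Ext A κ S S' → (∀ ω ∈ S'.event, ¬ P ω) → g₀ ≤ finMean F S'.event) →
    q * g₁ + (1 - q) * g₀ - κ * η ≤ finMean F S.event

/-! ### Rules for combining explorations -/

section Rules

variable {η : ℝ} {S : Known a} {A A' : Set (Item a)} {κ κ' : ℕ} {P P' : a.Sample → Prop} {q q' : ℝ}

theorem Explores.of_forall (hS : S.Good) (h : ∀ ω ∈ S.event, P ω) : Explores η S ∅ 0 P 1 := by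
  intro F _ g₁ g₀ _ _ h1 _
  simpa using h1 S (.refl hS) h

theorem Explores.of_forall_not (hS : S.Good) (h : ∀ ω ∈ S.event, ¬ P ω) : Explores η S ∅ 0 P 0 := by
  intro F _ g₁ g₀ _ _ _ h0
  simpa using h0 S (.refl hS) h

theorem Explores.congr (h : Explores η S A κ P q) (hP : ∀ ω ∈ S.event, P ω ↔ P' ω) :
    Explores η S A κ P' q := by
  intro F hF g₁ g₀ hg₁ hg₀ h1 h0
  exact h F hF g₁ g₀ hg₁ hg₀
    (fun S' hS' h' => h1 S' hS' fun ω hω => (hP ω (hS'.event_subset hω)).1 (h' ω hω))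
    (fun S' hS' h' => h0 S' hS' fun ω hω hp => h' ω hω ((hP ω (hS'.event_subset hω)).2 hp))

theorem Explores.not (h : Explores η S A κ P q) : Explores η S A κ (fun ω => ¬ P ω) (1 - q) := by
  intro F hF g₁ g₀ hg₁ hg₀ h1 h0
  have := h F hF g₀ g₁ hg₀ hg₁ (fun S' hS' h' => h0 S' hS' fun ω hω => not_not.2 (h' ω hω))
    (fun S' hS' h' => h1 S' hS' h')
  linarith

theorem Explores.mono (hη : 0 ≤ η) (h : Explores η S A κ P q)
    (hA : ∀ x ∈ A, x ∈ A' ∨ ¬ S.Touched x) (hκ : κ ≤ κ') : Explores η S A' κ' P q := by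
  intro F hF g₁ g₀ hg₁ hg₀ h1 h0
  have := h F hF g₁ g₀ hg₁ hg₀ (fun S' hS' => h1 S' (hS'.mono hA hκ))
    (fun S' hS' => h0 S' (hS'.mono hA hκ))
  have h2 : (κ : ℝ) * η ≤ κ' * η := mul_le_mul_of_nonneg_right (by exact_mod_cast hκ) hη
  linarith

/-- The second exploration is run only if the first finds `P` true. Its lower bound then plays the
role of `g₁` for the first, which is how the probabilities come to be multiplied. -/
theorem Explores.and (hη : 0 ≤ η) (hq1 : q ≤ 1) (hq' : 0 ≤ q') (hq1' : q' ≤ 1)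
    (h : Explores η S A κ P q)
    (h' : ∀ S', Ext A κ S S' → Explores η S' A' κ' P' q') :
    Explores η S (A ∪ A') (κ + κ') (fun ω => P ω ∧ P' ω) (q * q') := by
  intro F hF g₁ g₀ hg₁ hg₀ h1 h0
  have hκη : 0 ≤ (κ' : ℝ) * η := by positivity
  have key := h F hF (q' * g₁ + (1 - q') * g₀ - κ' * η) g₀ (by nlinarith) hg₀
    (fun S' hS' hP => h' S' hS' F hF g₁ g₀ hg₁ hg₀
      (fun S'' hS'' hP' => h1 S'' (hS'.trans hS'')
        fun ω hω => ⟨hP ω (hS''.event_subset hω), hP' ω hω⟩)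
      (fun S'' hS'' hP' => h0 S'' (hS'.trans hS'') fun ω hω hp => hP' ω hω hp.2))
    (fun S' hS' hP => h0 S' (hS'.mono (fun x hx => Or.inl (Or.inl hx)) (by omega))
      fun ω hω hp => hP ω hω hp.1)
  have : q * (κ' * η) ≤ κ' * η := by nlinarith
  push_cast
  nlinarith

/-- Iterated conjunction. The frame condition of `Ext` guarantees that exploring one item leaves the
remaining, already touched items unrevealed. The budget `M` bounds the size of everything known
along the way. -/
theorem Explores.forall_finset {ι : Type*} (hη : 0 ≤ η) (hq : 0 ≤ q) (hq1 : q ≤ 1)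
    {M : ℕ} (it : ι → Item a) (hit : Function.Injective it) {R : ι → a.Sample → Prop}
    (s : Finset ι)
    (h : ∀ i ∈ s, ∀ S : Known a, S.Good → S.Touched (it i) → ¬ S.Used (it i) → S.size + κ ≤ M →
      Explores η S {it i} κ (R i) q)
    (hS : S.Good) (ht : ∀ i ∈ s, S.Touched (it i)) (hu : ∀ i ∈ s, ¬ S.Used (it i))
    (hM : S.size + s.card * κ ≤ M) :
    Explores η S (it '' s) (s.card * κ) (fun ω => ∀ i ∈ s, R i ω) (q ^ s.card) := by
  classical
  induction s using Finset.induction_on generalizing S with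
  | empty => simpa using Explores.of_forall (η := η) (P := fun _ => True) hS (by simp)
  | insert i s his ih =>
    rw [Finset.card_insert_of_notMem his] at hM ⊢
    have hi := h i (Finset.mem_insert_self i s) S hS (ht i (Finset.mem_insert_self i s))
      (hu i (Finset.mem_insert_self i s)) (by nlinarith)
    have := Explores.and hη hq1 (pow_nonneg hq s.card) (pow_le_one₀ hq hq1) hi
      (fun S' hS' => ih (fun j hj => h j (Finset.mem_insert_of_mem hj)) hS'.good
        (fun j hj => hS'.touched (ht j (Finset.mem_insert_of_mem hj)))
        (fun j hj => hS'.not_used (ht j (Finset.mem_insert_of_mem hj))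
          (hu j (Finset.mem_insert_of_mem hj)) (fun hji => by
            have := hit (Set.mem_singleton_iff.1 hji)
            exact his (this ▸ hj)))
        (by have := hS'.size_le; nlinarith))
    rw [pow_succ']
    refine (this.congr fun ω _ => by simp).mono hη (fun x hx => Or.inl ?_) (by nlinarith)
    rcases hx with hx | ⟨j, hj, rfl⟩
    · exact ⟨i, by simp, (Set.mem_singleton_iff.1 hx).symm⟩
    · exact ⟨j, by simpa using Or.inr hj, rfl⟩

/-- Reveal the value of a symmetric query `f` first. The answers outside `G` are given up. -/
theorem Explores.query {β : Type*} [Fintype β] [DecidableEq β] (hη : 0 ≤ η) {f : a.Sample → β}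
    {B G : Finset β} (hf : IsSymmQuery S.event f B) (hGB : G ⊆ B)
    (hG : ((Finset.univ \ G).card : ℝ) ≤ η * Fintype.card β) (hβ : 0 < Fintype.card β)
    (T : β → Known a) (hT : ∀ b ∈ G, Ext A 2 S (T b))
    (hTe : ∀ b ∈ G, (T b).event = S.event.filter fun ω => f ω = b)
    (r : β → ℝ) (hr : ∀ b, 0 ≤ r b) (hr1 : ∀ b, r b ≤ 1)
    (h : ∀ b ∈ G, Explores η (T b) A' κ P (r b)) (hq : q = (∑ b, r b) / Fintype.card β) :
    Explores η S (A ∪ A') (κ + 2) P q := by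
  intro F hF g₁ g₀ hg₁ hg₀ h1 h0
  have hβ' : (0 : ℝ) < Fintype.card β := by exact_mod_cast hβ
  have hb : ∀ b ∈ G, r b * g₁ + (1 - r b) * g₀ - κ * η
      ≤ finMean F (S.event.filter fun ω => f ω = b) := fun b hb => by
    rw [← hTe b hb]
    exact h b hb F hF g₁ g₀ hg₁ hg₀
      (fun S' hS' => h1 S' (((hT b hb).trans hS').mono (fun _ hx => Or.inl hx) (by omega)))
      (fun S' hS' => h0 S' (((hT b hb).trans hS').mono (fun _ hx => Or.inl hx) (by omega)))
  have hκη : 0 ≤ (κ : ℝ) * η := by positivity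
  have hle := hf.le_finMean hF hGB
  have hsum := Finset.sum_le_sum hb
  -- The ideal contribution of a bad answer is at most 1, since `g₁` and `g₀` are, so giving all of
  -- them up costs at most `η` in the average.
  have hcompl : ∑ b ∈ Finset.univ \ G, (r b * g₁ + (1 - r b) * g₀ - κ * η)
      ≤ η * Fintype.card β := by
    refine le_trans (Finset.sum_le_card_nsmul _ _ 1 fun b _ => ?_) (by simpa using hG)
    nlinarith [hr b, hr1 b]
  have hsplit := Finset.sum_sdiff (Finset.subset_univ G)
    (f := fun b => r b * g₁ + (1 - r b) * g₀ - κ * η)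
  have htot : ∑ b, (r b * g₁ + (1 - r b) * g₀ - κ * η)
      = (q * g₁ + (1 - q) * g₀ - κ * η) * Fintype.card β := by
    have : ∑ b, r b = q * Fintype.card β := by rw [hq, div_mul_cancel₀ _ hβ'.ne']
    rw [Finset.sum_sub_distrib, Finset.sum_add_distrib, ← Finset.sum_mul, ← Finset.sum_mul,
      Finset.sum_sub_distrib, this]
    simp
    ring
  rw [div_le_iff₀ hβ'] at hle
  have : (q * g₁ + (1 - q) * g₀ - κ * η - η) * Fintype.card β
      ≤ finMean F S.event * Fintype.card β := by linarith
  have := le_of_mul_le_mul_right this hβ'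
  push_cast
  linarith

end Rules

/-! ### Revealing values -/

/-- Reveal that the half-edges `s` and `b` are matched. -/
def addPair (S : Known a) (s : a.VStub) (b : a.CStub) : Known a :=
  { S with pairs := insert (s, b) S.pairs, vns := insert s.1 S.vns, cns := insert b.1 S.cns }

/-- Reveal that the node `v` has position `p`, and touch the positions in `T`. -/
def addLabel (S : Known a) (v p : Fin n) (T : Finset (Fin n)) : Known a :=
  { S with labels := insert (v, p) S.labels, vns := insert v S.vns, pos := T ∪ S.pos }

/-- Reveal the bit at position `t`. -/
def addBit (S : Known a) (t : Fin n) (β : ZMod 2) : Known a :=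
  { S with bits := insert (t, β) S.bits }

variable {S : Known a}

theorem mem_event_addPair {s : a.VStub} {b : a.CStub} {ω : a.Sample} :
    ω ∈ (S.addPair s b).event ↔ ω ∈ S.event ∧ ω.1 s = b := by
  simp only [mem_event, addPair, Finset.forall_mem_insert]
  tauto

theorem mem_event_addLabel {v p : Fin n} {T : Finset (Fin n)} {ω : a.Sample} :
    ω ∈ (S.addLabel v p T).event ↔ ω ∈ S.event ∧ ω.2.1 v = p := by
  simp only [mem_event, addLabel, Finset.forall_mem_insert]
  tauto

theorem mem_event_addBit {t : Fin n} {β : ZMod 2} {ω : a.Sample} :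
    ω ∈ (S.addBit t β).event ↔ ω ∈ S.event ∧ ω.2.2 t = β := by
  simp only [mem_event, addBit, Finset.forall_mem_insert]
  tauto

/-- Composing the matching with the transposition of two unused answers exchanges them and preserves
all revealed pairs. The next three lemmas use the same swap. -/
theorem isSymmQuery_mate {s : a.VStub} (hs : ¬ S.Used (.vstub s)) :
    IsSymmQuery S.event (fun ω => ω.1 s) (Finset.univ \ S.pairs.image Prod.snd) := by
  refine ⟨fun ω hω => ?_, fun b hb b' hb' => ⟨fun ω => (ω.1.trans (Equiv.swap b b'), ω.2), ?_, ?_⟩⟩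
  · simp only [Finset.mem_sdiff, Finset.mem_univ, true_and, Finset.mem_image, not_exists, not_and]
    intro x hx hxs
    refine hs ⟨x, hx, ?_⟩
    exact ω.1.injective (((mem_event.1 hω).1 x hx).trans hxs)
  · rintro ⟨π, ρ⟩ ⟨π', ρ'⟩ h
    simp only [Prod.mk.injEq] at h
    refine Prod.ext (Equiv.ext fun x => ?_) h.2
    have := congrArg (fun e : a.VStub ≃ a.CStub => e x) h.1
    simpa using this
  · intro ω hω hωb
    refine ⟨mem_event.2 ⟨fun x hx => ?_, (mem_event.1 hω).2⟩, ?_⟩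
    · have h1 := (mem_event.1 hω).1 x hx
      have hb : x.2 ≠ b := fun h => (Finset.mem_sdiff.1 hb).2 (Finset.mem_image.2 ⟨x, hx, h⟩)
      have hb' : x.2 ≠ b' := fun h => (Finset.mem_sdiff.1 hb').2 (Finset.mem_image.2 ⟨x, hx, h⟩)
      simp [h1, Equiv.swap_apply_of_ne_of_ne hb hb']
    · simp [hωb]

theorem isSymmQuery_mate_symm {b : a.CStub} (hb : ¬ S.Used (.cstub b)) :
    IsSymmQuery S.event (fun ω => ω.1.symm b) (Finset.univ \ S.pairs.image Prod.fst) := by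
  refine ⟨fun ω hω => ?_, fun s hs s' hs' =>
    ⟨fun ω => ((Equiv.swap s s').trans ω.1, ω.2), ?_, ?_⟩⟩
  · simp only [Finset.mem_sdiff, Finset.mem_univ, true_and, Finset.mem_image, not_exists, not_and]
    intro x hx hxs
    refine hb ⟨x, hx, ?_⟩
    rw [← (mem_event.1 hω).1 x hx, hxs, Equiv.apply_symm_apply]
  · rintro ⟨π, ρ⟩ ⟨π', ρ'⟩ h
    simp only [Prod.mk.injEq] at h
    refine Prod.ext (Equiv.ext fun x => ?_) h.2
    have := congrArg (fun e : a.VStub ≃ a.CStub => e (Equiv.swap s s' x)) h.1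
    simpa using this
  · intro ω hω hωb
    refine ⟨mem_event.2 ⟨fun x hx => ?_, (mem_event.1 hω).2⟩, ?_⟩
    · have h1 := (mem_event.1 hω).1 x hx
      have hb : x.1 ≠ s := fun h => (Finset.mem_sdiff.1 hs).2 (Finset.mem_image.2 ⟨x, hx, h⟩)
      have hb' : x.1 ≠ s' := fun h => (Finset.mem_sdiff.1 hs').2 (Finset.mem_image.2 ⟨x, hx, h⟩)
      simp [h1, Equiv.swap_apply_of_ne_of_ne hb hb']
    · simp [hωb]

theorem isSymmQuery_label {v : Fin n} (hv : ¬ S.Used (.label v)) :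
    IsSymmQuery S.event (fun ω => ω.2.1 v) (Finset.univ \ S.labels.image Prod.snd) := by
  refine ⟨fun ω hω => ?_, fun b hb b' hb' =>
    ⟨fun ω => (ω.1, ω.2.1.trans (Equiv.swap b b'), ω.2.2), ?_, ?_⟩⟩
  · simp only [Finset.mem_sdiff, Finset.mem_univ, true_and, Finset.mem_image, not_exists, not_and]
    intro x hx hxs
    refine hv ⟨x, hx, ?_⟩
    exact ω.2.1.injective (((mem_event.1 hω).2.1 x hx).trans hxs)
  · rintro ⟨π, ρ, e⟩ ⟨π', ρ', e'⟩ h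
    simp only [Prod.mk.injEq] at h
    refine Prod.ext h.1 (Prod.ext (Equiv.ext fun x => ?_) h.2.2)
    have := congrArg (fun e : Equiv.Perm (Fin n) => e x) h.2.1
    simpa using this
  · intro ω hω hωb
    refine ⟨mem_event.2 ⟨(mem_event.1 hω).1, fun x hx => ?_, (mem_event.1 hω).2.2⟩, ?_⟩
    · have h1 := (mem_event.1 hω).2.1 x hx
      have hb : x.2 ≠ b := fun h => (Finset.mem_sdiff.1 hb).2 (Finset.mem_image.2 ⟨x, hx, h⟩)
      have hb' : x.2 ≠ b' := fun h => (Finset.mem_sdiff.1 hb').2 (Finset.mem_image.2 ⟨x, hx, h⟩)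
      simp [h1, Equiv.swap_apply_of_ne_of_ne hb hb']
    · simp [hωb]

theorem isSymmQuery_label_symm {p : Fin n} (hp : ∀ x ∈ S.labels, x.2 ≠ p) :
    IsSymmQuery S.event (fun ω => ω.2.1.symm p) (Finset.univ \ S.labels.image Prod.fst) := by
  refine ⟨fun ω hω => ?_, fun s hs s' hs' =>
    ⟨fun ω => (ω.1, (Equiv.swap s s').trans ω.2.1, ω.2.2), ?_, ?_⟩⟩
  · simp only [Finset.mem_sdiff, Finset.mem_univ, true_and, Finset.mem_image, not_exists, not_and]
    intro x hx hxs
    refine hp x hx ?_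
    rw [← (mem_event.1 hω).2.1 x hx, hxs, Equiv.apply_symm_apply]
  · rintro ⟨π, ρ, e⟩ ⟨π', ρ', e'⟩ h
    simp only [Prod.mk.injEq] at h
    refine Prod.ext h.1 (Prod.ext (Equiv.ext fun x => ?_) h.2.2)
    have := congrArg (fun e : Equiv.Perm (Fin n) => e (Equiv.swap s s' x)) h.2.1
    simpa using this
  · intro ω hω hωb
    refine ⟨mem_event.2 ⟨(mem_event.1 hω).1, fun x hx => ?_, (mem_event.1 hω).2.2⟩, ?_⟩
    · have h1 := (mem_event.1 hω).2.1 x hx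
      have hb : x.1 ≠ s := fun h => (Finset.mem_sdiff.1 hs).2 (Finset.mem_image.2 ⟨x, hx, h⟩)
      have hb' : x.1 ≠ s' := fun h => (Finset.mem_sdiff.1 hs').2 (Finset.mem_image.2 ⟨x, hx, h⟩)
      simp [h1, Equiv.swap_apply_of_ne_of_ne hb hb']
    · simp [hωb]

theorem isSymmQuery_bit {t : Fin n} (ht : ∀ x ∈ S.bits, x.1 ≠ t) :
    IsSymmQuery S.event (fun ω => ω.2.2 t) Finset.univ := by
  refine ⟨fun ω hω => Finset.mem_univ _, fun β _ β' _ =>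
    ⟨fun ω => (ω.1, ω.2.1, ω.2.2 + Pi.single t (β' - β)), ?_, ?_⟩⟩
  · rintro ⟨π, ρ, e⟩ ⟨π', ρ', e'⟩ h
    simp only [Prod.mk.injEq, add_left_inj] at h
    exact Prod.ext h.1 (Prod.ext h.2.1 h.2.2)
  · intro ω hω hωb
    refine ⟨mem_event.2 ⟨(mem_event.1 hω).1, (mem_event.1 hω).2.1, fun x hx => ?_⟩, ?_⟩
    · have h1 := (mem_event.1 hω).2.2 x hx
      simp [h1, ht x hx]
    · simp [hωb]

end Known

end DegreeAssignment

/-! ### Half-edges of a node -/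

theorem card_filter_sigma_fst_eq {k : ℕ} (d : Fin k → ℕ) (v : Fin k) :
    (Finset.univ.filter fun s : Σ i, Fin (d i) => s.1 = v).card = d v := by
  rw [show (Finset.univ.filter fun s : Σ i, Fin (d i) => s.1 = v)
      = Finset.univ.map (Function.Embedding.sigmaMk v) from ?_]
  · simp
  · ext ⟨i, j⟩
    simp only [Finset.mem_filter, Finset.mem_univ, true_and, Finset.mem_map,
      Function.Embedding.sigmaMk_apply]
    constructor
    · rintro rfl
      exact ⟨j, rfl⟩
    · rintro ⟨j', h⟩
      exact (congrArg Sigma.fst h).symm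

theorem card_filter_sigma_ne {k : ℕ} (d : Fin k → ℕ) (s : Σ i, Fin (d i)) :
    (Finset.univ.filter fun s' : Σ i, Fin (d i) => s' ≠ s ∧ s'.1 = s.1).card = d s.1 - 1 := by
  rw [← card_filter_sigma_fst_eq d s.1, ← Finset.card_erase_of_mem (a := s) (by simp)]
  congr 1
  ext s'
  simp

theorem card_filter_sigma_mem_le {k D : ℕ} (d : Fin k → ℕ) (hd : ∀ i, d i ≤ D)
    (X : Finset (Fin k)) : (Finset.univ.filter fun s : Σ i, Fin (d i) => s.1 ∈ X).card
      ≤ D * X.card := by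
  rw [Finset.card_eq_sum_card_fiberwise (f := Sigma.fst) (t := X) (fun s hs => by simpa using hs),
    mul_comm, ← smul_eq_mul]
  refine Finset.sum_le_card_nsmul _ _ _ fun v _ => le_trans (Finset.card_le_card ?_)
    ((card_filter_sigma_fst_eq d v).trans_le (hd v))
  intro s hs
  simp only [Finset.mem_filter, Finset.mem_univ, true_and] at hs ⊢
  exact hs.2

namespace DegreeAssignment

variable {n : ℕ}

/-! ### Erasures as a function of the erasure pattern

The binary word of a sample is now the erasure pattern, indexed by the positions of user `0`. -/

section

variable {a : DegreeAssignment n}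

/-- The MAC message to node `v` of user `u` is erased, if the check node messages in the previous
iteration were erased according to `C`. -/
def macErased (τ : ℕ) (ω : a.Sample) (C : Fin 2 → a.VStub → Prop) (u : Fin 2) (v : Fin n) : Prop :=
  ∃ p : Fin n, (p : ℕ) + delay τ (u + 1) = ω.2.1 v + delay τ u ∧
    ω.2.2 (if u = 0 then ω.2.1 v else p) = 1 ∧ ∀ s : a.VStub, s.1 = ω.2.1.symm p → C (u + 1) s

/-- The message along the half-edge `s` to its check node is erased. -/
def vcErased (τ : ℕ) (ω : a.Sample) (C : Fin 2 → a.VStub → Prop) (u : Fin 2) (s : a.VStub) : Prop :=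
  macErased τ ω C u s.1 ∧ ∀ t, t ≠ s → t.1 = s.1 → C u t

/-- The message from a check node along the half-edge `s` in iteration `l` is erased. -/
def cvErased (τ : ℕ) (ω : a.Sample) : ℕ → Fin 2 → a.VStub → Prop
  | 0, _, _ => True
  | l + 1, u, s => ∃ t, t ≠ s ∧ (ω.1 t).1 = (ω.1 s).1 ∧ vcErased τ ω (cvErased τ ω l) u t

/-- The node `v` of user `u` is erased after iteration `l + 1`. -/
def nodeErased (τ : ℕ) (ω : a.Sample) (l : ℕ) (u : Fin 2) (v : Fin n) : Prop :=
  macErased τ ω (cvErased τ ω l) u v ∧ ∀ s : a.VStub, s.1 = v → cvErased τ ω (l + 1) u s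

end

/-! ### Density evolution with the degrees of a finite graph -/

/-- The edge-perspective polynomial of the variable nodes. -/
noncomputable def vnEdge (a : DegreeAssignment n) (y : ℝ) : ℝ :=
  (∑ s : a.VStub, y ^ (a.dv s.1 - 1)) / Fintype.card a.VStub

/-- The node-perspective polynomial of the variable nodes, normalized by the blocklength. -/
noncomputable def vnNode (a : DegreeAssignment n) (y : ℝ) : ℝ :=
  (∑ v, y ^ a.dv v) / Fintype.card (Fin n)

/-- The erasure probability of the messages from check nodes to variable nodes. -/
noncomputable def deY (a : DegreeAssignment n) : ℕ → ℝ
  | 0 => 1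
  | l + 1 => (∑ b : a.CStub, (1 - (1 - 1 / 2 * a.vnNode (deY a l) * a.vnEdge (deY a l)) ^
      (a.dc b.1 - 1))) / Fintype.card a.CStub

theorem sum_div_card_mem_Icc {ι : Type*} [Fintype ι] {f : ι → ℝ} (h : ∀ i, f i ∈ Set.Icc (0 : ℝ) 1) :
    (∑ i, f i) / Fintype.card ι ∈ Set.Icc (0 : ℝ) 1 := by
  refine ⟨div_nonneg (Finset.sum_nonneg fun i _ => (h i).1) (Nat.cast_nonneg _),
    div_le_one_of_le₀ ?_ (Nat.cast_nonneg _)⟩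
  refine (Finset.sum_le_card_nsmul _ _ 1 fun i _ => (h i).2).trans ?_
  simp

theorem pow_mem_unitIcc {x : ℝ} (h : x ∈ Set.Icc (0 : ℝ) 1) (k : ℕ) :
    x ^ k ∈ Set.Icc (0 : ℝ) 1 :=
  ⟨pow_nonneg h.1 k, pow_le_one₀ h.1 h.2⟩

variable {a : DegreeAssignment n}

theorem vnEdge_mem {y : ℝ} (hy : y ∈ Set.Icc (0 : ℝ) 1) : a.vnEdge y ∈ Set.Icc (0 : ℝ) 1 :=
  sum_div_card_mem_Icc fun _ => pow_mem_unitIcc hy _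

theorem vnNode_mem {y : ℝ} (hy : y ∈ Set.Icc (0 : ℝ) 1) : a.vnNode y ∈ Set.Icc (0 : ℝ) 1 :=
  sum_div_card_mem_Icc fun _ => pow_mem_unitIcc hy _

theorem half_mul_mem {x : ℝ} (hx : x ∈ Set.Icc (0 : ℝ) 1) : 1 / 2 * x ∈ Set.Icc (0 : ℝ) 1 :=
  ⟨by linarith [hx.1], by linarith [hx.2]⟩

theorem one_sub_mem {x : ℝ} (hx : x ∈ Set.Icc (0 : ℝ) 1) : 1 - x ∈ Set.Icc (0 : ℝ) 1 :=
  ⟨by linarith [hx.2], by linarith [hx.1]⟩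

theorem mul_mem_unitIcc {x y : ℝ} (hx : x ∈ Set.Icc (0 : ℝ) 1) (hy : y ∈ Set.Icc (0 : ℝ) 1) :
    x * y ∈ Set.Icc (0 : ℝ) 1 :=
  ⟨mul_nonneg hx.1 hy.1, mul_le_one₀ hx.2 hy.1 hy.2⟩

theorem deY_mem (l : ℕ) : a.deY l ∈ Set.Icc (0 : ℝ) 1 := by
  induction l with
  | zero => simp [deY]
  | succ l ih =>
    exact sum_div_card_mem_Icc fun b => one_sub_mem (pow_mem_unitIcc (one_sub_mem
      (mul_mem_unitIcc (half_mul_mem (vnNode_mem ih)) (vnEdge_mem ih))) _)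

/-! ### Exploring the neighbourhood of a node -/

namespace Known

variable {S : Known a}

theorem ext_addPair (hS : S.Good) {s : a.VStub} {b : a.CStub}
    (hne : (S.addPair s b).event.Nonempty) :
    Ext {.vstub s, .cstub b} 2 S (S.addPair s b) := by
  refine ⟨⟨hne, ?_, ?_, hS.bits_touched⟩, fun ω hω => (mem_event_addPair.1 hω).1,
    Finset.subset_insert _ _, Finset.subset_insert _ _, ?_, ?_⟩
  · intro x hx
    rcases Finset.mem_insert.1 hx with rfl | hx
    · exact ⟨Finset.mem_insert_self _ _, Finset.mem_insert_self _ _⟩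
    · exact ⟨Finset.mem_insert_of_mem (hS.pairs_touched x hx).1,
        Finset.mem_insert_of_mem (hS.pairs_touched x hx).2⟩
  · intro x hx
    exact ⟨Finset.mem_insert_of_mem (hS.labels_touched x hx).1, (hS.labels_touched x hx).2⟩
  · rintro (s' | b' | v) ⟨x, hx, rfl⟩
    · rcases Finset.mem_insert.1 hx with rfl | hx
      · simp
      · exact Or.inl ⟨x, hx, rfl⟩
    · rcases Finset.mem_insert.1 hx with rfl | hx
      · simp
      · exact Or.inl ⟨x, hx, rfl⟩
    · exact Or.inl ⟨x, hx, rfl⟩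
  · have h1 := Finset.card_insert_le s.1 S.vns
    have h2 := Finset.card_insert_le b.1 S.cns
    simp only [size, addPair]
    omega

theorem ext_addLabel (hS : S.Good) {v p : Fin n} {T : Finset (Fin n)}
    (hne : (S.addLabel v p T).event.Nonempty) (hp : p ∈ T ∪ S.pos)
    (hsize : (insert v S.vns).card + T.card ≤ S.vns.card + 2) :
    Ext {.label v} 2 S (S.addLabel v p T) := by
  refine ⟨⟨hne, ?_, ?_, ?_⟩, fun ω hω => (mem_event_addLabel.1 hω).1,
    Finset.subset_insert _ _, subset_rfl, ?_, ?_⟩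
  · intro x hx
    exact ⟨Finset.mem_insert_of_mem (hS.pairs_touched x hx).1, (hS.pairs_touched x hx).2⟩
  · intro x hx
    rcases Finset.mem_insert.1 hx with rfl | hx
    · exact ⟨Finset.mem_insert_self _ _, hp⟩
    · exact ⟨Finset.mem_insert_of_mem (hS.labels_touched x hx).1,
        Finset.mem_union_right _ (hS.labels_touched x hx).2⟩
  · intro x hx
    exact Finset.mem_union_right _ (hS.bits_touched x hx)
  · rintro (s' | b' | v) ⟨x, hx, rfl⟩
    · exact Or.inl ⟨x, hx, rfl⟩
    · exact Or.inl ⟨x, hx, rfl⟩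
    · rcases Finset.mem_insert.1 hx with rfl | hx
      · simp
      · exact Or.inl ⟨x, hx, rfl⟩
  · have h2 := Finset.card_union_le T S.pos
    simp only [size, addLabel]
    omega

theorem ext_addBit (hS : S.Good) {t : Fin n} {β : ZMod 2}
    (hne : (S.addBit t β).event.Nonempty) (ht : t ∈ S.pos) :
    Ext ∅ 2 S (S.addBit t β) := by
  refine ⟨⟨hne, hS.pairs_touched, hS.labels_touched, ?_⟩, fun ω hω => (mem_event_addBit.1 hω).1,
    subset_rfl, subset_rfl, ?_, ?_⟩
  · intro x hx
    rcases Finset.mem_insert.1 hx with rfl | hx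
    · exact ht
    · exact hS.bits_touched x hx
  · rintro (s' | b' | v) ⟨x, hx, rfl⟩ <;> exact Or.inl ⟨x, hx, rfl⟩
  · simp [size, addBit]

/-- Touching at most `M` of the nodes of `a` and shifting by `τ` affects only a fraction `η` of the
half-edges and of the positions. -/
structure _root_.DegreeAssignment.Sparse (a : DegreeAssignment n) (τ D M : ℕ) (η : ℝ) : Prop where
  nonneg : 0 ≤ η
  one_le : 1 ≤ τ
  dv_le : ∀ v, a.dv v ≤ D
  dc_le : ∀ c, a.dc c ≤ D
  stubs : (D * M : ℝ) ≤ η * Fintype.card a.VStub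
  positions : (2 * M + τ : ℝ) ≤ η * n

variable {τ D M : ℕ} {η : ℝ}

/-- Only positions outside the overlap have no partner: the first `τ` for user 0 and the last `τ`
for user 1. The latter are counted by reflecting the frame. -/
theorem card_no_partner_le (τ : ℕ) (u : Fin 2) :
    (Finset.univ.filter fun p : Fin n => ¬ ∃ p' : Fin n, (p' : ℕ) + delay τ (u + 1)
      = p + delay τ u).card ≤ τ := by
  rw [← Finset.card_range τ]
  fin_cases u
  · refine Finset.card_le_card_of_injOn (fun p => (p : ℕ)) (fun p hp => ?_)
      (Fin.val_injective.injOn)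
    by_contra h
    have hle : τ ≤ p := by simpa using h
    have := p.2
    exact (Finset.mem_filter.1 hp).2 ⟨⟨p - τ, by omega⟩, by simp [delay, hle]⟩
  · refine Finset.card_le_card_of_injOn (fun p => n - 1 - (p : ℕ)) (fun p hp => ?_)
      (fun p _ p' _ h => Fin.ext (by have := p.2; have := p'.2; simp only at h; omega))
    by_contra h
    have hle : τ ≤ n - 1 - p := by simpa using h
    have := p.2
    exact (Finset.mem_filter.1 hp).2 ⟨⟨p + τ, by omega⟩, by simp [delay]⟩

/-- The exponent is the exact number of half-edges, but the cost is relaxed to one that depends only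
on `D`. -/
theorem explores_all_stubs {κ : ℕ} {y : ℝ} {R : a.VStub → a.Sample → Prop} (hs : a.Sparse τ D M η)
    (hy : y ∈ Set.Icc (0 : ℝ) 1)
    (ih : ∀ s, ∀ S : Known a, S.Good → S.Touched (.vstub s) → ¬ S.Used (.vstub s) →
      S.size + κ ≤ M → Explores η S {.vstub s} κ (R s) y)
    (hS : S.Good) (X : Finset a.VStub) (hXD : X.card ≤ D) (ht : ∀ s ∈ X, S.Touched (.vstub s))
    (hu : ∀ s ∈ X, ¬ S.Used (.vstub s)) (hM : S.size + D * κ ≤ M) :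
    Explores η S (Item.vstub '' X) (D * κ) (fun ω => ∀ s ∈ X, R s ω) (y ^ X.card) := by
  have hle : X.card * κ ≤ D * κ := Nat.mul_le_mul_right _ hXD
  exact (Explores.forall_finset hs.nonneg hy.1 hy.2 Item.vstub (fun _ _ h => Item.vstub.inj h) X
    (fun s _ => ih s) hS ht hu (by omega)).mono hs.nonneg (fun _ hx => Or.inl hx) hle

/-- Three queries of cost 2 each are made: the position of `v`, the node at the partner position,
the bit of the erasure pattern. The partner node is almost uniform, which produces the average
`vnNode`, and the bit produces the factor 1/2. Its half-edges account for `D * κ`. -/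
theorem explores_mac {κ : ℕ} {y : ℝ} {C : a.Sample → Fin 2 → a.VStub → Prop}
    (hs : a.Sparse τ D M η) (hy : y ∈ Set.Icc (0 : ℝ) 1)
    (ih : ∀ u s, ∀ S : Known a, S.Good → S.Touched (.vstub s) → ¬ S.Used (.vstub s) →
      S.size + κ ≤ M → Explores η S {.vstub s} κ (fun ω => C ω u s) y)
    (u : Fin 2) (v : Fin n) (hS : S.Good) (hv : S.Touched (.label v)) (hu : ¬ S.Used (.label v))
    (hM : S.size + (D * κ + 6) ≤ M) :
    Explores η S {.label v} (D * κ + 6) (fun ω => macErased τ ω (C ω) u v)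
      (1 / 2 * a.vnNode y) := by
  classical
  have hη := hs.nonneg
  have hn : 0 < Fintype.card (Fin n) := by simpa using v.pos
  have hτ := hs.one_le
  have hvnode := half_mul_mem (vnNode_mem (a := a) hy)
  have hpos : S.pos.card ≤ S.size := by simp only [size]; omega
  let Pt : Fin n → Fin n → Prop := fun p p' => (p' : ℕ) + delay τ (u + 1) = p + delay τ u
  let par : Fin n → Fin n := fun p => if h : ∃ p', Pt p p' then h.choose else p
  have hpar : ∀ p, (∃ p', Pt p p') → Pt p (par p) := fun p h => by
    simp only [par, dif_pos h]; exact h.choose_spec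
  have hPt : ∀ p p' p'', Pt p p' → Pt p p'' → p' = p'' := fun p p' p'' h h' =>
    Fin.ext (by simp only [Pt] at h h'; omega)
  have hPt' : ∀ p p' p'', Pt p' p → Pt p'' p → p' = p'' := fun p p' p'' h h' =>
    Fin.ext (by simp only [Pt] at h h'; omega)
  -- A positive delay is essential here: otherwise the partner of `v` would be `v` itself.
  have hPne : ∀ p p', Pt p p' → p' ≠ p := by
    rintro p p' h rfl
    simp only [Pt, delay] at h
    fin_cases u <;> simp at h <;> omega
  -- Both the position and its partner must be fresh, because the relevant pattern bit is indexed by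
  -- either of them, depending on the user. Both are touched at once below. The bad positions number
  -- at most `2 * M + τ`.
  let G : Finset (Fin n) := Finset.univ.filter fun p => p ∉ S.pos ∧ (∃ p', Pt p p') ∧ par p ∉ S.pos
  have hG : ((Finset.univ \ G).card : ℝ) ≤ η * Fintype.card (Fin n) := by
    have hsub : Finset.univ \ G ⊆ S.pos ∪ (Finset.univ.filter fun p => ¬ ∃ p', Pt p p') ∪
        (Finset.univ.filter fun p => (∃ p', Pt p p') ∧ par p ∈ S.pos) := by
      intro p
      simp only [G, Finset.mem_sdiff, Finset.mem_filter, Finset.mem_univ, true_and,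
        Finset.mem_union]
      tauto
    have h3 : (Finset.univ.filter fun p => (∃ p', Pt p p') ∧ par p ∈ S.pos).card ≤ S.pos.card := by
      refine Finset.card_le_card_of_injOn par (fun p hp => (Finset.mem_filter.1 hp).2.2)
        (fun p hp p' hp' h => ?_)
      have h1 := hpar p (Finset.mem_filter.1 hp).2.1
      have h2 := hpar p' (Finset.mem_filter.1 hp').2.1
      rw [h] at h1
      exact hPt' _ _ _ h1 h2
    have h2 : (Finset.univ.filter fun p => ¬ ∃ p', Pt p p').card ≤ τ := card_no_partner_le τ u
    have h4 := Finset.card_le_card hsub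
    have h5 := Finset.card_union_le (S.pos ∪ (Finset.univ.filter fun p => ¬ ∃ p', Pt p p'))
      (Finset.univ.filter fun p => (∃ p', Pt p p') ∧ par p ∈ S.pos)
    have h6 := Finset.card_union_le S.pos (Finset.univ.filter fun p => ¬ ∃ p', Pt p p')
    have h7 : (Finset.univ \ G).card ≤ 2 * M + τ := by omega
    have h8 := hs.positions
    simp only [Fintype.card_fin]
    refine le_trans ?_ h8
    exact_mod_cast h7
  have hq1 := isSymmQuery_label hu
  have hGB : G ⊆ Finset.univ \ S.labels.image Prod.snd := by
    intro p hp
    simp only [Finset.mem_sdiff, Finset.mem_univ, true_and, Finset.mem_image, not_exists, not_and]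
    rintro x hx rfl
    exact (Finset.mem_filter.1 hp).2.1 (hS.labels_touched x hx).2
  have he1 : ∀ p, (S.addLabel v p {p, par p}).event = S.event.filter fun ω => ω.2.1 v = p :=
    fun p => by ext ω; rw [mem_event_addLabel, Finset.mem_filter]
  have hT1 : ∀ p ∈ G, Ext {.label v} 2 S (S.addLabel v p {p, par p}) := fun p hp => by
    refine ext_addLabel hS ?_ (by simp) ?_
    · rw [he1]
      exact hq1.nonempty hS.nonempty (hGB hp)
    · rw [Finset.insert_eq_of_mem hv]
      have := Finset.card_le_two (a := p) (b := par p)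
      omega
  refine (Explores.query (A' := ∅) (κ := D * κ + 4) hη hq1 hGB hG hn
    (fun p => S.addLabel v p {p, par p}) hT1 (fun p _ => he1 p) (fun _ => 1 / 2 * a.vnNode y)
    (fun _ => hvnode.1) (fun _ => hvnode.2) (fun p hp => ?_) ?_).mono hη
    (fun x hx => Or.inl (by simpa using hx)) le_rfl
  swap
  · rw [Finset.sum_const, nsmul_eq_mul, Finset.card_univ,
      mul_div_cancel_left₀ _ (by exact_mod_cast hn.ne')]
  have hp1 := (Finset.mem_filter.1 hp).2
  have hpp := hpar p hp1.2.1
  have hext1 := hT1 p hp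
  set S₁ := S.addLabel v p {p, par p} with hS₁
  have hS₁l : ∀ x ∈ S₁.labels, x.2 ≠ par p := by
    intro x hx h
    rcases Finset.mem_insert.1 hx with rfl | hx
    · exact hPne _ _ hpp h.symm
    · exact hp1.2.2 (h ▸ (hS.labels_touched x hx).2)
  have hS₁b : ∀ x ∈ S₁.bits, x.1 ∈ S.pos := fun x hx => hS.bits_touched x hx
  have hq2 := isSymmQuery_label_symm hS₁l
  let G₂ : Finset (Fin n) := Finset.univ.filter fun v' => v' ∉ S₁.vns
  have hG₂ : ((Finset.univ \ G₂).card : ℝ) ≤ η * Fintype.card (Fin n) := by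
    have h1 : Finset.univ \ G₂ = S₁.vns := by ext; simp [G₂]
    have h2 : S₁.vns.card ≤ S₁.size := by simp only [size]; omega
    have h3 := hext1.size_le
    have h4 : S₁.vns.card ≤ 2 * M + τ := by omega
    have h8 := hs.positions
    simp only [h1, Fintype.card_fin]
    exact le_trans (by exact_mod_cast h4) h8
  have hGB₂ : G₂ ⊆ Finset.univ \ S₁.labels.image Prod.fst := by
    intro v' hv'
    simp only [Finset.mem_sdiff, Finset.mem_univ, true_and, Finset.mem_image, not_exists, not_and]
    rintro x hx rfl
    exact (Finset.mem_filter.1 hv').2 (hext1.good.labels_touched x hx).1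
  have he2 : ∀ v', (S₁.addLabel v' (par p) ∅).event
      = S₁.event.filter fun ω => ω.2.1.symm (par p) = v' := fun v' => by
    ext ω
    rw [mem_event_addLabel, Finset.mem_filter, Equiv.symm_apply_eq, eq_comm (a := par p)]
  have hpS₁ : par p ∈ S₁.pos ∧ p ∈ S₁.pos := by simp [hS₁, addLabel]
  have hT2 : ∀ v' ∈ G₂, Ext {.label v'} 2 S₁ (S₁.addLabel v' (par p) ∅) := fun v' hv' => by
    refine ext_addLabel hext1.good ?_ (by simp [hpS₁.1]) ?_
    · rw [he2]
      exact hq2.nonempty hext1.good.nonempty (hGB₂ hv')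
    · have := Finset.card_insert_le v' S₁.vns
      simp only [Finset.card_empty]
      omega
  -- The items of the partner node become touched only now, so they are described by being untouched
  -- in `S₁` and vanish from the list of the outer exploration.
  refine (Explores.query (A := ∅) (A' := {x | ¬ S₁.Touched x}) (κ := D * κ + 2) hη hq2 hGB₂ hG₂ hn
    (fun v' => S₁.addLabel v' (par p) ∅) (fun v' hv' => (hT2 v' hv').mono (fun x hx => Or.inr ?_)
      le_rfl) (fun v' _ => he2 v') (fun v' => 1 / 2 * y ^ a.dv v')
    (fun v' => (half_mul_mem (pow_mem_unitIcc hy _)).1)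
    (fun v' => (half_mul_mem (pow_mem_unitIcc hy _)).2) (fun v' hv' => ?_) ?_).mono hη
    (fun x hx => Or.inr (by simpa using hx)) le_rfl
  · rw [Set.mem_singleton_iff.1 hx]
    exact (Finset.mem_filter.1 hv').2
  swap
  · rw [vnNode, ← Finset.mul_sum, mul_div_assoc]
  have hext2 := hT2 v' hv'
  have hv'1 := (Finset.mem_filter.1 hv').2
  set S₂ := S₁.addLabel v' (par p) ∅ with hS₂
  set t := if u = 0 then p else par p with ht
  have htS : t ∉ S.pos := by
    rw [ht]; split_ifs
    exacts [hp1.1, hp1.2.2]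
  have htS₂ : t ∈ S₂.pos := by
    have h0 : S₂.pos = S₁.pos := by simp [hS₂, addLabel]
    rw [h0, ht]; split_ifs
    exacts [hpS₁.2, hpS₁.1]
  have hq3 := isSymmQuery_bit (S := S₂) (t := t) (fun x hx h => htS (h ▸ hS₁b x hx))
  have he3 : ∀ β, (S₂.addBit t β).event = S₂.event.filter fun ω => ω.2.2 t = β :=
    fun β => by ext ω; rw [mem_event_addBit, Finset.mem_filter]
  have hT3 : ∀ β ∈ (Finset.univ : Finset (ZMod 2)), Ext ∅ 2 S₂ (S₂.addBit t β) := fun β hβ =>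
    ext_addBit hext2.good (by rw [he3]; exact hq3.nonempty hext2.good.nonempty hβ) htS₂
  -- A fresh bit has no bad answers. The value 0 ends the exploration, because a channel output that
  -- is not erased determines the MAC message.
  refine (Explores.query (A := ∅) (A' := {x | ¬ S₁.Touched x}) (κ := D * κ) hη hq3 subset_rfl
    (by simp; positivity) (by simp) (fun β => S₂.addBit t β) hT3 (fun β _ => he3 β)
    (fun β => if β = 1 then y ^ a.dv v' else 0) (fun β => ?_) (fun β => ?_) (fun β hβ => ?_)
    ?_).mono hη (fun x hx => Or.inl (by simpa using hx)) le_rfl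
  · split_ifs
    exacts [pow_nonneg hy.1 _, le_rfl]
  · split_ifs
    exacts [pow_le_one₀ hy.1 hy.2, zero_le_one]
  swap
  · rw [Finset.sum_ite_eq' Finset.univ (1 : ZMod 2)]
    simp
    ring
  have hext3 := hT3 β hβ
  have hval : ∀ ω ∈ (S₂.addBit t β).event, ω.2.1 v = p ∧ ω.2.1.symm (par p) = v' ∧ ω.2.2 t = β := by
    intro ω hω
    obtain ⟨h1, h2⟩ := mem_event_addBit.1 hω
    obtain ⟨h3, h4⟩ := mem_event_addLabel.1 h1
    obtain ⟨h5, h6⟩ := mem_event_addLabel.1 h3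
    exact ⟨h6, by rw [← h4, Equiv.symm_apply_apply], h2⟩
  have hiff : ∀ ω ∈ (S₂.addBit t β).event, macErased τ ω (C ω) u v ↔
      β = 1 ∧ ∀ s ∈ Finset.univ.filter (fun s : a.VStub => s.1 = v'), C ω (u + 1) s := by
    intro ω hω
    obtain ⟨h1, h2, h3⟩ := hval ω hω
    simp only [macErased, h1, Finset.mem_filter, Finset.mem_univ, true_and]
    constructor
    · rintro ⟨p', hp', hb, hc⟩
      obtain rfl : p' = par p := hPt p _ _ hp' hpp
      exact ⟨h3.symm.trans hb, by rwa [h2] at hc⟩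
    · rintro ⟨hb, hc⟩
      exact ⟨par p, hpp, h3.trans hb, by rwa [h2]⟩
  by_cases hβ1 : β = 1
  · simp only [hβ1, if_true] at hext3 hiff ⊢
    have hut : ∀ s ∈ Finset.univ.filter (fun s : a.VStub => s.1 = v'), ¬ S₁.Touched (.vstub s) :=
      fun s hs h => hv'1 (by simpa [(Finset.mem_filter.1 hs).2, Touched] using h)
    have hsz2 := hext2.size_le
    have hsz1 := hext1.size_le
    have hsz3 := hext3.size_le
    have := explores_all_stubs (S := S₂.addBit t 1) hs hy (ih (u + 1)) hext3.good
      (Finset.univ.filter fun s : a.VStub => s.1 = v')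
      (by rw [card_filter_sigma_fst_eq]; exact hs.dv_le v')
      (fun s hs => by
        simp only [Finset.mem_filter, Finset.mem_univ, true_and] at hs
        simp [Touched, addBit, hS₂, addLabel, hs])
      (fun s hs => by
        rintro ⟨x, hx, rfl⟩
        exact hut _ hs (hext1.good.pairs_touched x hx).1) (by omega)
    rw [card_filter_sigma_fst_eq] at this
    refine (this.congr fun ω hω => ?_).mono hη (fun x hx => Or.inl ?_) le_rfl
    · rw [hiff ω hω]; simp
    · obtain ⟨s, hs, rfl⟩ := hx
      exact hut s hs
  · simp only [hβ1, if_false]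
    exact (Explores.of_forall_not hext3.good fun ω hω h => hβ1 ((hiff ω hω).1 h).1).mono hη
      (fun x hx => hx.elim) (Nat.zero_le _)

/-- The MAC exploration does not reveal the half-edges at the node of `s`, as that node is already
touched. The two conditions can therefore be explored in succession, and their probabilities
multiply. -/
theorem explores_vc {κ : ℕ} {y : ℝ} {C : a.Sample → Fin 2 → a.VStub → Prop}
    (hs : a.Sparse τ D M η) (hy : y ∈ Set.Icc (0 : ℝ) 1)
    (ih : ∀ u s, ∀ S : Known a, S.Good → S.Touched (.vstub s) → ¬ S.Used (.vstub s) →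
      S.size + κ ≤ M → Explores η S {.vstub s} κ (fun ω => C ω u s) y)
    (u : Fin 2) (s : a.VStub) (hS : S.Good) (hv : s.1 ∈ S.vns) (hu : ¬ S.Used (.label s.1))
    (hus : ∀ s', s' ≠ s → s'.1 = s.1 → ¬ S.Used (.vstub s'))
    (hM : S.size + (2 * (D * κ) + 6) ≤ M) :
    Explores η S ({.label s.1} ∪ Item.vstub '' {s' | s'.1 = s.1}) (2 * (D * κ) + 6)
      (fun ω => vcErased τ ω (C ω) u s) (1 / 2 * a.vnNode y * y ^ (a.dv s.1 - 1)) := by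
  classical
  have hη := hs.nonneg
  have hz := half_mul_mem (vnNode_mem (a := a) hy)
  have hw := pow_mem_unitIcc hy (a.dv s.1 - 1)
  have key := (explores_mac hs hy ih u s.1 hS hv hu (by omega)).and
    (A' := Item.vstub '' (Finset.univ.filter fun s' : a.VStub => s' ≠ s ∧ s'.1 = s.1))
    (κ' := D * κ)
    (P' := fun ω => ∀ s' ∈ Finset.univ.filter fun s' : a.VStub => s' ≠ s ∧ s'.1 = s.1, C ω u s')
    hη hz.2 hw.1 hw.2 (fun S' hS' => by
      have h1 := hS'.size_le
      rw [← card_filter_sigma_ne a.dv s]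
      refine explores_all_stubs hs hy (ih u) hS'.good _ ?_ (fun s' hs' => ?_) (fun s' hs' => ?_)
        (by omega)
      · rw [card_filter_sigma_ne a.dv s]
        exact (Nat.sub_le _ _).trans (hs.dv_le _)
      · refine hS'.touched (x := .vstub s') ?_
        simp only [Touched, (Finset.mem_filter.1 hs').2.2, hv]
      · refine hS'.not_used (x := .vstub s') ?_ (hus s' ?_ ?_) (by simp)
        · simp only [Touched, (Finset.mem_filter.1 hs').2.2, hv]
        · exact (Finset.mem_filter.1 hs').2.1
        · exact (Finset.mem_filter.1 hs').2.2)
  refine (key.congr fun ω _ => ?_).mono hη (fun x hx => Or.inl ?_) (by omega)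
  · simp only [vcErased, Finset.mem_filter, Finset.mem_univ, true_and, and_imp]
  · rcases hx with hx | ⟨s', hs', rfl⟩
    · exact Or.inl hx
    · exact Or.inr ⟨s', (Finset.mem_filter.1 hs').2.2, rfl⟩

/-- The mate of `b` is an almost uniform half-edge, so it sees variable nodes with the
edge-perspective distribution; this produces `vnEdge`. Everything at the new node was untouched,
which leaves `b` as the only listed item. -/
theorem explores_cstub {κ : ℕ} {y : ℝ} {C : a.Sample → Fin 2 → a.VStub → Prop}
    (hs : a.Sparse τ D M η) (hy : y ∈ Set.Icc (0 : ℝ) 1)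
    (ih : ∀ u s, ∀ S : Known a, S.Good → S.Touched (.vstub s) → ¬ S.Used (.vstub s) →
      S.size + κ ≤ M → Explores η S {.vstub s} κ (fun ω => C ω u s) y)
    (u : Fin 2) (b : a.CStub) (S : Known a) (hS : S.Good)
    (hu : ¬ S.Used (.cstub b)) (hM : S.size + (2 * (D * κ) + 8) ≤ M) :
    Explores η S {.cstub b} (2 * (D * κ) + 8) (fun ω => vcErased τ ω (C ω) u (ω.1.symm b))
      (1 / 2 * a.vnNode y * a.vnEdge y) := by
  classical
  have hη := hs.nonneg
  have hz := half_mul_mem (vnNode_mem (a := a) hy)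
  have hq := isSymmQuery_mate_symm hu
  obtain ⟨ω₀, hω₀⟩ := hS.nonempty
  have hN : 0 < Fintype.card a.VStub := Fintype.card_pos_iff.2 ⟨ω₀.1.symm b⟩
  let G : Finset a.VStub := Finset.univ.filter fun s => s.1 ∉ S.vns
  have hG : ((Finset.univ \ G).card : ℝ) ≤ η * Fintype.card a.VStub := by
    have h1 : Finset.univ \ G = Finset.univ.filter fun s => s.1 ∈ S.vns := by ext; simp [G]
    have h2 := card_filter_sigma_mem_le a.dv hs.dv_le S.vns
    have h3 : S.vns.card ≤ M := by simp only [size] at hM; omega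
    have h4 := h2.trans (Nat.mul_le_mul_left D h3)
    rw [h1]
    exact le_trans (by exact_mod_cast h4) hs.stubs
  have hGB : G ⊆ Finset.univ \ S.pairs.image Prod.fst := by
    intro s hsG
    simp only [Finset.mem_sdiff, Finset.mem_univ, true_and, Finset.mem_image, not_exists, not_and]
    rintro x hx rfl
    exact (Finset.mem_filter.1 hsG).2 (hS.pairs_touched x hx).1
  have he : ∀ s, (S.addPair s b).event = S.event.filter fun ω => ω.1.symm b = s := fun s => by
    ext ω
    rw [mem_event_addPair, Finset.mem_filter, Equiv.symm_apply_eq, eq_comm (a := b)]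
  have hT : ∀ s ∈ G, Ext {.vstub s, .cstub b} 2 S (S.addPair s b) := fun s hsG =>
    ext_addPair hS (by rw [he]; exact hq.nonempty hS.nonempty (hGB hsG))
  refine (Explores.query (A := {.cstub b}) (A' := {x | ¬ S.Touched x}) (κ := 2 * (D * κ) + 6) hη hq
    hGB hG hN (fun s => S.addPair s b) (fun s hsG => (hT s hsG).mono (fun x hx => ?_) le_rfl)
    (fun s _ => he s) (fun s => 1 / 2 * a.vnNode y * y ^ (a.dv s.1 - 1))
    (fun s => (mul_mem_unitIcc hz (pow_mem_unitIcc hy _)).1)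
    (fun s => (mul_mem_unitIcc hz (pow_mem_unitIcc hy _)).2) (fun s hsG => ?_) ?_).mono hη
    (fun x hx => hx) le_rfl
  · rcases hx with rfl | hx
    · exact Or.inr (Finset.mem_filter.1 hsG).2
    · exact Or.inl hx
  · have hext := hT s hsG
    have hsS := (Finset.mem_filter.1 hsG).2
    have hsz := hext.size_le
    refine ((explores_vc (S := S.addPair s b) hs hy ih u s hext.good (Finset.mem_insert_self _ _)
      ?_ ?_ (by omega)).congr fun ω hω => ?_).mono hη (fun x hx => Or.inl ?_) le_rfl
    · rintro ⟨x, hx, hxs⟩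
      exact hsS (hxs ▸ (hS.labels_touched x hx).1)
    · rintro s' hne hs' ⟨x, hx, rfl⟩
      rcases Finset.mem_insert.1 hx with rfl | hx
      · exact hne rfl
      · exact hsS (hs' ▸ (hS.pairs_touched x hx).1)
    · rw [← (mem_event_addPair.1 hω).2, Equiv.symm_apply_apply]
    · rcases hx with rfl | ⟨s', hs', rfl⟩
      · exact hsS
      · rw [Set.mem_ofPred_eq] at hs'
        simpa [Touched, hs'] using hsS
  · rw [vnEdge, ← Finset.mul_sum, mul_div_assoc]

/-- The cost of the exploration of a message from a check node. -/
def _root_.DegreeAssignment.cvCost (D : ℕ) : ℕ → ℕ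
  | 0 => 0
  | l + 1 => D * (2 * (D * cvCost D l) + 8) + 2

theorem explores_cv (hs : a.Sparse τ D M η) (l : ℕ) (u : Fin 2) (s : a.VStub) (S : Known a)
    (hS : S.Good) (ht : S.Touched (.vstub s)) (hu : ¬ S.Used (.vstub s))
    (hM : S.size + cvCost D l ≤ M) :
    Explores η S {.vstub s} (cvCost D l) (fun ω => cvErased τ ω l u s) (a.deY l) := by
  classical
  have hη := hs.nonneg
  induction l generalizing u s S with
  | zero =>
    exact (Explores.of_forall hS fun ω _ => trivial).mono hη (fun x hx => hx.elim) le_rfl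
  | succ l ih =>
    have hy := deY_mem (a := a) l
    have hx := mul_mem_unitIcc (half_mul_mem (vnNode_mem (a := a) hy)) (vnEdge_mem (a := a) hy)
    have hx' := one_sub_mem hx
    set x := 1 / 2 * a.vnNode (a.deY l) * a.vnEdge (a.deY l) with hxdef
    have hr : ∀ b : a.CStub, 1 - (1 - x) ^ (a.dc b.1 - 1) ∈ Set.Icc (0 : ℝ) 1 := fun b =>
      one_sub_mem (pow_mem_unitIcc hx' _)
    have hcard : Fintype.card a.CStub = Fintype.card a.VStub := by
      obtain ⟨ω₀, -⟩ := hS.nonempty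
      exact (Fintype.card_congr ω₀.1).symm
    have hN : 0 < Fintype.card a.CStub := hcard ▸ Fintype.card_pos_iff.2 ⟨s⟩
    have hq := isSymmQuery_mate hu
    let G : Finset a.CStub := Finset.univ.filter fun b => b.1 ∉ S.cns
    have hG : ((Finset.univ \ G).card : ℝ) ≤ η * Fintype.card a.CStub := by
      have h1 : Finset.univ \ G = Finset.univ.filter fun b => b.1 ∈ S.cns := by ext; simp [G]
      have h2 := card_filter_sigma_mem_le a.dc hs.dc_le S.cns
      have h3 : S.cns.card ≤ M := by simp only [size] at hM; omega
      have h4 := h2.trans (Nat.mul_le_mul_left D h3)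
      rw [h1, hcard]
      exact le_trans (by exact_mod_cast h4) hs.stubs
    have hGB : G ⊆ Finset.univ \ S.pairs.image Prod.snd := by
      intro b hb
      simp only [Finset.mem_sdiff, Finset.mem_univ, true_and, Finset.mem_image, not_exists, not_and]
      rintro x hx rfl
      exact (Finset.mem_filter.1 hb).2 (hS.pairs_touched x hx).2
    have he : ∀ b, (S.addPair s b).event = S.event.filter fun ω => ω.1 s = b := fun b => by
      ext ω; rw [mem_event_addPair, Finset.mem_filter]
    have hT : ∀ b ∈ G, Ext {.vstub s, .cstub b} 2 S (S.addPair s b) := fun b hb =>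
      ext_addPair hS (by rw [he]; exact hq.nonempty hS.nonempty (hGB hb))
    refine (Explores.query (A := {.vstub s}) (A' := {x | ¬ S.Touched x})
      (κ := D * (2 * (D * cvCost D l) + 8)) hη hq
      hGB hG hN (fun b => S.addPair s b) (fun b hb => (hT b hb).mono (fun x hx => ?_) le_rfl)
      (fun b _ => he b) (fun b => 1 - (1 - x) ^ (a.dc b.1 - 1)) (fun b => (hr b).1)
      (fun b => (hr b).2) (fun b hb => ?_) rfl).mono hη (fun x hx => hx) le_rfl
    · rcases hx with rfl | rfl
      · exact Or.inl rfl
      · exact Or.inr (Finset.mem_filter.1 hb).2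
    · have hext := hT b hb
      have hbS := (Finset.mem_filter.1 hb).2
      have hsz := hext.size_le
      rw [cvCost] at hM
      have hle : (Finset.univ.filter fun b' : a.CStub => b' ≠ b ∧ b'.1 = b.1).card ≤ D := by
        rw [card_filter_sigma_ne a.dc b]
        exact (Nat.sub_le _ _).trans (hs.dc_le _)
      have hle' := Nat.mul_le_mul_right (2 * (D * cvCost D l) + 8) hle
      -- A check node message survives exactly when all other incoming messages do. The conjunction
      -- rule is applied to the negations, which gives the power of `1 - x`, and the result is
      -- negated again.
      have key := (Explores.forall_finset (S := S.addPair s b) (M := M)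
        (κ := 2 * (D * cvCost D l) + 8) hη hx'.1 hx'.2 Item.cstub (fun _ _ h => Item.cstub.inj h)
        (R := fun b' ω => ¬ vcErased τ ω (cvErased τ ω l) u (ω.1.symm b'))
        (Finset.univ.filter fun b' : a.CStub => b' ≠ b ∧ b'.1 = b.1)
        (fun b' _ S hS _ hu hM => (explores_cstub hs hy ih u b' S hS hu hM).not)
        hext.good ?_ ?_ (by omega)).not
      · rw [card_filter_sigma_ne a.dc b] at key hle'
        refine (key.congr fun ω hω => ?_).mono hη (fun x hx => Or.inl ?_) hle'
        · have hωb := (mem_event_addPair.1 hω).2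
          simp only [cvErased, Finset.mem_filter, Finset.mem_univ, true_and, not_forall, not_not,
            hωb]
          constructor
          · rintro ⟨b', ⟨h1, h2⟩, h3⟩
            refine ⟨ω.1.symm b', fun h => h1 ?_, by simpa using h2, h3⟩
            rw [← hωb, ← h, Equiv.apply_symm_apply]
          · rintro ⟨s', h1, h2, h3⟩
            exact ⟨ω.1 s', ⟨fun h => h1 (ω.1.injective (h.trans hωb.symm)), h2⟩, by simpa using h3⟩
        · obtain ⟨b', hb', rfl⟩ := hx
          have hb' := (Finset.mem_filter.1 hb').2.2
          simpa [Touched, hb'] using hbS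
      · intro b' hb'
        simp [Touched, addPair, (Finset.mem_filter.1 hb').2.2]
      · rintro b' hb' ⟨x, hx, rfl⟩
        rcases Finset.mem_insert.1 hx with rfl | hx
        · exact (Finset.mem_filter.1 hb').2.1 rfl
        · exact hbS ((Finset.mem_filter.1 hb').2.2 ▸ (hS.pairs_touched x hx).2)

/-- The cost of the exploration of a node. -/
def _root_.DegreeAssignment.nodeCost (D l : ℕ) : ℕ :=
  (D * cvCost D l + 6) + D * cvCost D (l + 1)

theorem explores_node (hs : a.Sparse τ D M η) (l : ℕ) (u : Fin 2) (v : Fin n) (S : Known a)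
    (hS : S.Good) (hv : v ∈ S.vns) (hu : ¬ S.Used (.label v))
    (hus : ∀ s : a.VStub, s.1 = v → ¬ S.Used (.vstub s)) (hM : S.size + nodeCost D l ≤ M) :
    Explores η S ({.label v} ∪ Item.vstub '' {s | s.1 = v}) (nodeCost D l)
      (fun ω => nodeErased τ ω l u v)
      (1 / 2 * a.vnNode (a.deY l) * a.deY (l + 1) ^ a.dv v) := by
  classical
  have hη := hs.nonneg
  have hy := deY_mem (a := a) l
  have hy' := deY_mem (a := a) (l + 1)
  have hz := half_mul_mem (vnNode_mem (a := a) hy)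
  have hw := pow_mem_unitIcc hy' (a.dv v)
  rw [nodeCost] at hM
  have key := (explores_mac hs hy (explores_cv hs l) u v hS hv hu (by omega)).and
    (A' := Item.vstub '' (Finset.univ.filter fun s : a.VStub => s.1 = v))
    (κ' := D * cvCost D (l + 1))
    (P' := fun ω => ∀ s ∈ Finset.univ.filter fun s : a.VStub => s.1 = v, cvErased τ ω (l + 1) u s)
    hη hz.2 hw.1 hw.2 (fun S' hS' => by
      have h1 := hS'.size_le
      rw [← card_filter_sigma_fst_eq a.dv v]
      refine explores_all_stubs hs hy' (explores_cv hs (l + 1) u) hS'.good _ ?_ (fun s' hs' => ?_)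
        (fun s' hs' => ?_) (by omega)
      · rw [card_filter_sigma_fst_eq a.dv v]
        exact hs.dv_le _
      · refine hS'.touched (x := .vstub s') ?_
        simp only [Touched, (Finset.mem_filter.1 hs').2, hv]
      · refine hS'.not_used (x := .vstub s') ?_ (hus s' (Finset.mem_filter.1 hs').2) (by simp)
        simp only [Touched, (Finset.mem_filter.1 hs').2, hv])
  refine (key.congr fun ω _ => ?_).mono hη (fun x hx => Or.inl ?_) le_rfl
  · simp only [nodeErased, Finset.mem_filter, Finset.mem_univ, true_and]
  · rcases hx with hx | ⟨s', hs', rfl⟩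
    · exact Or.inl hx
    · exact Or.inr ⟨s', (Finset.mem_filter.1 hs').2, rfl⟩

end Known

end DegreeAssignment

/-! ### Second moment of the erased fraction -/

theorem finMean_sum {Ω ι : Type*} (s : Finset ι) (F : ι → Ω → ℝ) (A : Finset Ω) :
    finMean (fun ω => ∑ i ∈ s, F i ω) A = ∑ i ∈ s, finMean (F i) A := by
  simp only [finMean, ← Finset.sum_div]
  rw [Finset.sum_comm]

theorem finMean_mono {Ω : Type*} {F F' : Ω → ℝ} {A : Finset Ω} (h : ∀ ω ∈ A, F ω ≤ F' ω) :
    finMean F A ≤ finMean F' A :=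
  div_le_div_of_nonneg_right (Finset.sum_le_sum h) (Nat.cast_nonneg _)

theorem finMean_const_le {Ω : Type*} {c : ℝ} (hc : 0 ≤ c) (A : Finset Ω) :
    finMean (fun _ => c) A ≤ c := by
  rcases A.eq_empty_or_nonempty with rfl | hA
  · simpa [finMean] using hc
  · exact (finMean_eq_of_forall hA fun _ _ => rfl).le

theorem finMean_add {Ω : Type*} (F F' : Ω → ℝ) (A : Finset Ω) :
    finMean (fun ω => F ω + F' ω) A = finMean F A + finMean F' A := by
  simp only [finMean, Finset.sum_add_distrib, add_div]

theorem finMean_const_mul {Ω : Type*} (c : ℝ) (F : Ω → ℝ) (A : Finset Ω) :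
    finMean (fun ω => c * F ω) A = c * finMean F A := by
  simp only [finMean, ← Finset.mul_sum, mul_div_assoc]

namespace DegreeAssignment

variable {n : ℕ} {a : DegreeAssignment n}

instance : Nonempty a.Sample := by
  have h : Fintype.card a.VStub = Fintype.card a.CStub := by
    simpa [Fintype.card_sigma] using a.sum_eq
  exact ⟨Fintype.equivOfCardEq h, 1, 0⟩

open Classical in
/-- The fraction of the `2 n` nodes that are erased after iteration `l + 1`. -/
noncomputable def erasedFrac (τ : ℕ) (l : ℕ) (ω : a.Sample) : ℝ :=
  ((Finset.univ.filter fun p : Fin 2 × Fin n => nodeErased τ ω l p.1 p.2).card : ℝ) / (2 * n)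

/-- The erasure probability of the bits with the degrees of a finite graph. -/
noncomputable def deBit (a : DegreeAssignment n) (l : ℕ) : ℝ :=
  1 / 2 * a.vnNode (a.deY l) * a.vnNode (a.deY (l + 1))

/-- The erasure indicator of a node, minus its erasure probability in density evolution. -/
noncomputable def erasureDev (τ l : ℕ) (r : Fin 2 × Fin n) (ω : a.Sample) : ℝ :=
  open Classical in
  (if nodeErased τ ω l r.1 r.2 then 1 else 0) -
    1 / 2 * a.vnNode (a.deY l) * a.deY (l + 1) ^ a.dv r.2

theorem node_prob_mem (l : ℕ) (v : Fin n) :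
    1 / 2 * a.vnNode (a.deY l) * a.deY (l + 1) ^ a.dv v ∈ Set.Icc (0 : ℝ) 1 :=
  mul_mem_unitIcc (half_mul_mem (vnNode_mem (deY_mem l))) (pow_mem_unitIcc (deY_mem (l + 1)) _)

theorem abs_erasureDev_le (τ l : ℕ) (r : Fin 2 × Fin n) (ω : a.Sample) :
    |erasureDev τ l r ω| ≤ 1 := by
  obtain ⟨h0, h1⟩ := node_prob_mem (a := a) l r.2
  rw [erasureDev, abs_le]
  split_ifs <;> constructor <;> linarith

theorem erasureDev_mul_le (τ l : ℕ) (r r' : Fin 2 × Fin n) (ω : a.Sample) :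
    erasureDev τ l r ω * erasureDev τ l r' ω ≤ 1 := by
  refine (le_abs_self _).trans ?_
  rw [abs_mul]
  exact mul_le_one₀ (abs_erasureDev_le τ l r ω) (abs_nonneg _) (abs_erasureDev_le τ l r' ω)

/-- Given the outcome of exploring the first node, the deviation at the second still has conditional
mean almost zero. The budget counts the two starting nodes and two explorations. -/
theorem finMean_erasureDev_mul_le {τ D M : ℕ} {η : ℝ} (hs : a.Sparse τ D M η) (l : ℕ)
    (hM : 2 + 2 * nodeCost D l ≤ M) (r r' : Fin 2 × Fin n) (hr : r.2 ≠ r'.2) :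
    finMean (fun ω : a.Sample => erasureDev τ l r ω * erasureDev τ l r' ω) Finset.univ
      ≤ 4 * nodeCost D l * η := by
  have hη := hs.nonneg
  -- Both nodes are touched from the start although nothing is revealed, so the first exploration
  -- cannot reveal items at the second node.
  let S : Known a := ⟨∅, ∅, ∅, {r.2, r'.2}, ∅, ∅⟩
  have hSe : S.event = Finset.univ := by
    ext ω; simp [Known.mem_event, S]
  have hS : S.Good := ⟨by rw [hSe]; exact Finset.univ_nonempty, by simp [S], by simp [S],
    by simp [S]⟩
  have hunused : ∀ x, ¬ S.Used x := by
    rintro (s | b | v) ⟨x, hx, -⟩ <;> exact absurd hx (by simp [S])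
  have hsize : S.size ≤ 2 := by
    have := Finset.card_le_two (a := r.2) (b := r'.2)
    simpa [Known.size, S] using this
  set κ := nodeCost D l
  have hκη : 0 ≤ (κ : ℝ) * η := by positivity
  obtain ⟨hq0, hq1⟩ := node_prob_mem (a := a) l r.2
  obtain ⟨hq0', hq1'⟩ := node_prob_mem (a := a) l r'.2
  set q := 1 / 2 * a.vnNode (a.deY l) * a.deY (l + 1) ^ a.dv r.2 with hq
  set q' := 1 / 2 * a.vnNode (a.deY l) * a.deY (l + 1) ^ a.dv r'.2 with hq'
  -- An affine function of minus the product, scaled so that it is nonnegative and its conditional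
  -- values are at most 1. A lower bound for its mean is an upper bound for the correlation.
  let F : a.Sample → ℝ := fun ω => (1 - erasureDev τ l r ω * erasureDev τ l r' ω) / 2
  have hF : ∀ ω, 0 ≤ F ω := fun ω => by
    have := erasureDev_mul_le τ l r r' ω
    simp only [F]; linarith
  have hvals : ∀ r ω, (nodeErased τ ω l r.1 r.2 → erasureDev τ l r ω
      = 1 - 1 / 2 * a.vnNode (a.deY l) * a.deY (l + 1) ^ a.dv r.2) ∧
      (¬ nodeErased τ ω l r.1 r.2 → erasureDev τ l r ω
      = 0 - 1 / 2 * a.vnNode (a.deY l) * a.deY (l + 1) ^ a.dv r.2) := fun r ω =>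
    ⟨fun h => by rw [erasureDev, if_pos h], fun h => by rw [erasureDev, if_neg h]⟩
  -- The two conditional values of `F` average to exactly 1/2 under `q'`, whichever outcome `b` the
  -- first node had. Each exploration loses `κ * η`, and undoing the scaling doubles the loss to `4
  -- * κ * η`.
  have second : ∀ S', Known.Ext ({.label r.2} ∪ Item.vstub '' {s | s.1 = r.2}) κ S S' →
      ∀ b : ℝ, 0 ≤ b → b ≤ 1 → (∀ ω ∈ S'.event, erasureDev τ l r ω = b - q) →
      1 / 2 - κ * η ≤ finMean F S'.event := by
    intro S' hS' b hb0 hb1 hb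
    have hsz := hS'.size_le
    have hnot : ∀ x : Item a, S.Touched x →
        x ∉ ({.label r.2} ∪ Item.vstub '' {s | s.1 = r.2} : Set (Item a)) → ¬ S'.Used x :=
      fun x hx hxA => hS'.not_used hx (hunused x) hxA
    have key := Known.explores_node hs l r'.1 r'.2 S' hS'.good
      (hS'.vns_subset (by simp [S]))
      (hnot _ (by simp [S, Known.Touched]) (by simpa using hr.symm))
      (fun s hs => hnot _ (by simp [S, Known.Touched, hs])
        (by
          rintro (h | ⟨s', hs', h⟩)
          · cases Set.mem_singleton_iff.1 h
          · cases Item.vstub.inj h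
            exact hr (Eq.trans (Eq.symm hs') hs)))
      (by omega) F hF ((1 - (b - q) * (1 - q')) / 2) ((1 - (b - q) * (0 - q')) / 2)
      (by nlinarith) (by nlinarith) ?_ ?_
    · have : q' * ((1 - (b - q) * (1 - q')) / 2) + (1 - q') * ((1 - (b - q) * (0 - q')) / 2)
          = 1 / 2 := by ring
      rw [← hq', this] at key
      exact key
    · intro S'' hS'' hP
      refine (finMean_eq_of_forall hS''.good.nonempty fun ω hω => ?_).ge
      simp only [F, hb ω (hS''.event_subset hω), (hvals r' ω).1 (hP ω hω), hq']
    · intro S'' hS'' hP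
      refine (finMean_eq_of_forall hS''.good.nonempty fun ω hω => ?_).ge
      simp only [F, hb ω (hS''.event_subset hω), (hvals r' ω).2 (hP ω hω), hq']
  have first := Known.explores_node hs l r.1 r.2 S hS (by simp [S]) (hunused _)
    (fun s _ => hunused _) (by omega) F hF (1 / 2 - κ * η) (1 / 2 - κ * η) (by linarith)
    (by linarith)
    (fun S' hS' hP => second S' hS' 1 zero_le_one le_rfl fun ω hω => (hvals r ω).1 (hP ω hω))
    (fun S' hS' hP => second S' hS' 0 le_rfl zero_le_one fun ω hω => (hvals r ω).2 (hP ω hω))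
  have hmean : finMean F S.event = 1 / 2 - 1 / 2 *
      finMean (fun ω : a.Sample => erasureDev τ l r ω * erasureDev τ l r' ω) Finset.univ := by
    have h1 : finMean (fun _ : a.Sample => (1 / 2 : ℝ)) Finset.univ = 1 / 2 :=
      finMean_eq_of_forall Finset.univ_nonempty fun _ _ => rfl
    have h2 : F = fun ω => 1 / 2 + (-(1 / 2)) * (erasureDev τ l r ω * erasureDev τ l r' ω) := by
      funext ω; simp only [F]; ring
    rw [hSe, h2, finMean_add, h1, finMean_const_mul]
    ring
  rw [hmean] at first
  nlinarith

theorem erasedFrac_sub_eq (τ l : ℕ) (hn : 0 < n) (ω : a.Sample) :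
    erasedFrac τ l ω - a.deBit l = (∑ r : Fin 2 × Fin n, erasureDev τ l r ω) / (2 * n) := by
  classical
  have hn' : (n : ℝ) ≠ 0 := by exact_mod_cast hn.ne'
  have h1 : ∑ r : Fin 2 × Fin n, 1 / 2 * a.vnNode (a.deY l) * a.deY (l + 1) ^ a.dv r.2
      = a.deBit l * (2 * n) := by
    rw [Fintype.sum_prod_type]
    simp only [← Finset.mul_sum, Finset.sum_const, Finset.card_univ, Fintype.card_fin, deBit]
    rw [vnNode, vnNode]
    simp only [Fintype.card_fin]
    field_simp
    ring
  simp only [erasureDev]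
  rw [Finset.sum_sub_distrib, h1, Finset.sum_boole, sub_div, erasedFrac,
    mul_div_cancel_right₀ _ (by positivity)]

/-- The mean square deviation of the erasure rate from density evolution. -/
theorem finMean_erasedFrac_sub_sq_le {τ D M : ℕ} {η : ℝ} (hs : a.Sparse τ D M η) (l : ℕ)
    (hM : 2 + 2 * nodeCost D l ≤ M) (hn : 0 < n) :
    finMean (fun ω : a.Sample => (erasedFrac τ l ω - a.deBit l) ^ 2) Finset.univ
      ≤ 4 * nodeCost D l * η + 1 / n := by
  have hn' : (0 : ℝ) < n := by exact_mod_cast hn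
  have hη := hs.nonneg
  set c := 4 * nodeCost D l * η with hc
  have hc0 : 0 ≤ c := by positivity
  have hexp : (fun ω : a.Sample => (erasedFrac τ l ω - a.deBit l) ^ 2)
      = fun ω => (1 / (2 * n : ℝ) ^ 2) * ∑ r : Fin 2 × Fin n, ∑ r' : Fin 2 × Fin n,
        erasureDev τ l r ω * erasureDev τ l r' ω := by
    funext ω
    rw [erasedFrac_sub_eq τ l hn, div_pow, sq (∑ r, _), Finset.sum_mul_sum]
    ring
  rw [hexp, finMean_const_mul, finMean_sum]
  simp only [finMean_sum]
  have hle : ∀ r r' : Fin 2 × Fin n,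
      finMean (fun ω : a.Sample => erasureDev τ l r ω * erasureDev τ l r' ω) Finset.univ
        ≤ c + if r.2 = r'.2 then 1 else 0 := by
    intro r r'
    split_ifs with h
    · refine (finMean_mono fun ω _ => erasureDev_mul_le τ l r r' ω).trans ?_
      exact (finMean_const_le zero_le_one _).trans (by linarith)
    · simpa using finMean_erasureDev_mul_le hs l hM r r' h
  have hsum := Finset.sum_le_sum fun r (_ : r ∈ Finset.univ) =>
    Finset.sum_le_sum fun r' (_ : r' ∈ Finset.univ) => hle r r'
  -- Each of the `n` nodes occurs for both users, so `4 * n` ordered pairs share a node; for these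
  -- the trivial bound 1 is used.
  have htot : ∑ r : Fin 2 × Fin n, ∑ r' : Fin 2 × Fin n, (c + if r.2 = r'.2 then 1 else 0)
      = (2 * n : ℝ) ^ 2 * c + 4 * n := by
    simp only [Finset.sum_add_distrib, Fintype.sum_prod_type, Finset.sum_const, Finset.card_univ,
      Fintype.card_prod, Fintype.card_fin, Finset.sum_ite_eq, Finset.mem_univ, if_true, nsmul_eq_mul]
    push_cast
    ring
  rw [htot] at hsum
  calc _ ≤ 1 / (2 * n : ℝ) ^ 2 * ((2 * n : ℝ) ^ 2 * c + 4 * n) :=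
        mul_le_mul_of_nonneg_left hsum (by positivity)
    _ = c + 1 / n := by field_simp; ring

end DegreeAssignment

/-! ### Erasures in belief propagation -/

theorem delayed_eq {n : ℕ} {α : Type} (dflt : α) {s t : ℕ} (f : Fin n → α) (p : Fin n)
    (h : (p : ℕ) + s = t) : delayed dflt s f t = f p := by
  have hp := p.2
  rw [delayed, dif_pos (by omega)]
  congr 1
  exact Fin.ext (by simp only; omega)

theorem delayed_eq_default {n : ℕ} {α : Type} (dflt : α) {s t : ℕ} (f : Fin n → α)
    (h : ¬ ∃ p : Fin n, (p : ℕ) + s = t) : delayed dflt s f t = dflt := by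
  rw [delayed, dif_neg]
  rintro ⟨h1, h2⟩
  exact h ⟨⟨t - s, h2⟩, by simp only; omega⟩

theorem vnRule_eq_none {S : Set Msg} : vnRule S = none ↔ ∀ x ∈ S, x = none := by
  unfold vnRule
  constructor
  · intro h x hx
    split_ifs at h with h0 h1
    rcases x with _ | b
    · rfl
    · fin_cases b
      exacts [absurd hx h0, absurd hx h1]
  · intro h
    rw [if_neg fun h0 => (Option.some_ne_none _ (h _ h0)),
      if_neg fun h0 => (Option.some_ne_none _ (h _ h0))]

theorem cnRule_eq_none {E : Type} {s : ZMod 2} {S : Finset E} {q : E → Msg} :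
    cnRule s S q = none ↔ ∃ e ∈ S, q e = none := by
  unfold cnRule
  split_ifs with h
  · simp only [false_iff, not_exists, not_and]
    exact h
  · simpa using h

theorem macRule_bpsk_add (x y : ZMod 2) (w : Msg) :
    macRule (bpsk x + bpsk y) w = none ↔ x + y = 1 ∧ w = none := by
  revert x y w
  decide

theorem macRule_bpsk (x : ZMod 2) (w : Msg) : macRule (bpsk x) w ≠ none := by
  revert x w
  decide

/-- The erasure pattern of the channel, indexed by the positions of user `0`: in the overlap, the
output is erased if and only if the two bits have sum `1`. -/
def erasurePattern {n : ℕ} (τ : ℕ) (b : Fin 2 → Fin n → ZMod 2) (t : Fin n) : ZMod 2 :=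
  b 0 t + delayed 0 τ (b 1) t

/-- In the overlap two symbols `±1` cancel exactly when the bits differ, that is, have sum 1.
Outside it a single symbol is observed and is never erased. -/
theorem macMsg_eq_none {n : ℕ} {E : Type} (τ : ℕ) (b : Fin 2 → Fin n → ZMod 2) (S : BPState n E)
    (u : Fin 2) (i : Fin n) : macMsg τ (channelOut τ b) S u i = none ↔
      ∃ p : Fin n, (p : ℕ) + delay τ (u + 1) = i + delay τ u ∧
        erasurePattern τ b (if u = 0 then i else p) = 1 ∧ S.vm (u + 1) p = none := by
  have hout : channelOut τ b (i + delay τ u) = bpsk (b u i) +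
      delayed 0 (delay τ (u + 1)) (fun i => bpsk (b (u + 1) i)) (i + delay τ u) := by
    have hself : delayed 0 (delay τ u) (fun i => bpsk (b u i)) (i + delay τ u) = bpsk (b u i) :=
      delayed_eq 0 _ i rfl
    rw [← hself, channelOut, Fin.sum_univ_two]
    fin_cases u
    · rfl
    · exact add_comm _ _
  rw [macMsg, hout]
  by_cases h : ∃ p : Fin n, (p : ℕ) + delay τ (u + 1) = i + delay τ u
  · obtain ⟨p, hp⟩ := h
    rw [delayed_eq _ _ p hp, delayed_eq _ _ p hp, macRule_bpsk_add]
    have hpat : erasurePattern τ b (if u = 0 then i else p) = b u i + b (u + 1) p := by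
      fin_cases u
      · exact congrArg (b 0 i + ·) (delayed_eq 0 (b 1) p hp)
      · refine (congrArg (b 0 p + ·) (delayed_eq 0 (b 1) i ?_)).trans (add_comm _ _)
        simpa [delay] using hp.symm
    constructor
    · rintro ⟨h1, h2⟩
      exact ⟨p, hp, hpat.trans h1, h2⟩
    · rintro ⟨p', hp', h1, h2⟩
      obtain rfl : p' = p := Fin.ext (by omega)
      exact ⟨hpat.symm.trans h1, h2⟩
  · rw [delayed_eq_default _ _ h, add_zero]
    refine iff_of_false (macRule_bpsk _ _) ?_
    rintro ⟨p, hp, -⟩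
    exact h ⟨p, hp⟩

/-- A fixed translate of the dither by codewords gives every erasure pattern once. -/
theorem erasurePattern_bijective {n : ℕ} {τ : ℕ} (hτ : 1 ≤ τ) (c : Fin 2 → Fin n → ZMod 2) :
    Function.Bijective fun d : Fin n → ZMod 2 => erasurePattern τ fun u => c u + d := by
  refine Finite.injective_iff_bijective.1 fun d d' h => ?_
  have key : ∀ k (hk : k < n), d ⟨k, hk⟩ = d' ⟨k, hk⟩ := by
    intro k
    -- The dither is recovered from left to right: the pattern at `k` involves only `d k` and `d (k
    -- - τ)`, and the latter is already known.
    induction k using Nat.strong_induction_on with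
    | _ k ih =>
      intro hk
      have h1 := congrFun h ⟨k, hk⟩
      simp only [erasurePattern, Pi.add_apply] at h1
      by_cases hle : τ ≤ k
      · have hlt : k - τ < n := by omega
        have hd := ih (k - τ) (by omega) hlt
        rw [delayed_eq 0 _ ⟨k - τ, hlt⟩ (by simp only; omega),
          delayed_eq 0 _ ⟨k - τ, hlt⟩ (by simp only; omega)] at h1
        simp only [Pi.add_apply, hd] at h1
        exact add_left_cancel (add_right_cancel h1)
      -- Before the overlap the default 0 leaves the bit of user 0 alone. These entries describe no
      -- erasure, but they make the map a bijection.
      · have hne : ¬ ∃ p : Fin n, (p : ℕ) + τ = k := by rintro ⟨p, hp⟩; omega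
        rw [delayed_eq_default 0 _ hne, delayed_eq_default 0 _ hne, add_zero, add_zero] at h1
        exact add_left_cancel h1
  exact funext fun i => key i i.2

namespace DegreeAssignment

variable {n : ℕ} {a : DegreeAssignment n}

section

variable (τ : ℕ) (b : Fin 2 → Fin n → ZMod 2) (π : a.VStub ≃ a.CStub) (σ : Equiv.Perm (Fin n))
  (s : Fin a.m → ZMod 2)

theorem macMsg_eq_none_iff_macErased {S : BPState n a.VStub} {C : Fin 2 → a.VStub → Prop}
    (hS : ∀ u i, S.vm u i = none ↔ ∀ s : a.VStub, s.1 = σ.symm i → C u s) (u : Fin 2) (i : Fin n) :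
    macMsg τ (channelOut τ b) S u i = none ↔
      macErased τ (a := a) (π, σ, erasurePattern τ b) C u (σ.symm i) := by
  simp only [macMsg_eq_none, macErased, Equiv.apply_symm_apply, hS]

/-- None of the three node rules lets the value of a message influence whether the reply is erased,
apart from the channel output. Hence codewords and dither enter only through the erasure pattern,
and the parities not at all. Positions are translated to nodes by `σ.symm`. -/
theorem bpState_eq_none (l : ℕ) :
    (∀ u e, (bpState (a.graph π σ) s τ (channelOut τ b) l).cv u e = none ↔
      cvErased τ (a := a) (π, σ, erasurePattern τ b) l u e) ∧
    ∀ u i, (bpState (a.graph π σ) s τ (channelOut τ b) l).vm u i = none ↔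
      ∀ s : a.VStub, s.1 = σ.symm i → cvErased τ (a := a) (π, σ, erasurePattern τ b) l u s := by
  induction l with
  | zero => simp [bpState, cvErased]
  | succ l ih =>
    have hvc : ∀ u e, vcMsg (a.graph π σ) τ (channelOut τ b)
        (bpState (a.graph π σ) s τ (channelOut τ b) l) u e = none ↔
        vcErased τ (a := a) (π, σ, erasurePattern τ b)
          (cvErased τ (a := a) (π, σ, erasurePattern τ b) l) u e := by
      intro u e
      have hmac := macMsg_eq_none_iff_macErased τ b π σ ih.2 u (σ e.1)
      rw [Equiv.symm_apply_apply] at hmac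
      rw [vcMsg, vnRule_eq_none, vcErased, ← hmac]
      constructor
      · intro h
        refine ⟨h _ (Or.inl rfl), fun s' hs' hv => (ih.1 u s').1 (h _ (Or.inr ⟨s', hs', ?_, rfl⟩))⟩
        exact congrArg σ hv
      · rintro ⟨h1, h2⟩ x (rfl | ⟨e', he', hv, rfl⟩)
        · exact h1
        · exact (ih.1 u e').2 (h2 e' he' (σ.injective hv))
    have hcv : ∀ u e, (bpState (a.graph π σ) s τ (channelOut τ b) (l + 1)).cv u e = none ↔
        cvErased τ (a := a) (π, σ, erasurePattern τ b) (l + 1) u e := by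
      intro u e
      have hcv : (bpState (a.graph π σ) s τ (channelOut τ b) (l + 1)).cv u e
          = cvMsg (a.graph π σ) s τ (channelOut τ b)
            (bpState (a.graph π σ) s τ (channelOut τ b) l) u e := rfl
      simp only [hcv, cvMsg, cnRule_eq_none, hvc, cvErased, Finset.mem_filter, Finset.mem_univ,
        true_and, and_assoc]
      rfl
    refine ⟨hcv, fun u i => ?_⟩
    have hvm : (bpState (a.graph π σ) s τ (channelOut τ b) (l + 1)).vm u i
        = vnRule {x | ∃ e, (a.graph π σ).vn e = i ∧
          x = (bpState (a.graph π σ) s τ (channelOut τ b) (l + 1)).cv u e} := rfl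
    rw [hvm, vnRule_eq_none]
    constructor
    · intro h s' hs'
      exact (hcv u s').1 (h _ ⟨s', (Equiv.eq_symm_apply σ).1 hs', rfl⟩)
    · rintro h x ⟨e, he, rfl⟩
      exact (hcv u e).2 (h e ((Equiv.eq_symm_apply σ).2 he))

theorem vnValue_eq_none (l : ℕ) (u : Fin 2) (i : Fin n) :
    vnValue (a.graph π σ) s τ (channelOut τ b) (l + 1) u i = none ↔
      nodeErased τ (a := a) (π, σ, erasurePattern τ b) l u (σ.symm i) := by
  rw [vnValue, vnRule_eq_none, nodeErased,
    ← macMsg_eq_none_iff_macErased τ b π σ (bpState_eq_none τ b π σ s l).2 u i]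
  constructor
  · intro h
    refine ⟨h _ (Or.inl rfl), fun e he => ((bpState_eq_none τ b π σ s (l + 1)).1 u e).1
      (h _ (Or.inr ⟨e, (Equiv.eq_symm_apply σ).1 he, rfl⟩))⟩
  · rintro ⟨h1, h2⟩ x (rfl | ⟨e, he, rfl⟩)
    · exact h1
    · exact ((bpState_eq_none τ b π σ s (l + 1)).1 u e).2 (h2 e ((Equiv.eq_symm_apply σ).2 he))

theorem ber_eq_erasedFrac (d : Fin n → ZMod 2) (c : Fin 2 → Fin n → ZMod 2) (l : ℕ) :
    ber (a.graph π σ) d τ c (l + 1) =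
      erasedFrac τ l (a := a) (π, σ, erasurePattern τ fun u => c u + d) := by
  rw [ber, erasedFrac]
  congr 2
  refine Finset.card_equiv ((Equiv.refl (Fin 2)).prodCongr σ.symm) fun p => ?_
  simp only [Finset.mem_filter, Finset.mem_univ, true_and, vnValue_eq_none]
  rfl

end

/-- Averaging over pairs of codewords does not increase the mean square deviation. -/
theorem sq_avgBER_sub_le {m : ℕ} {E : Type} [Fintype E] [DecidableEq E] (G : TannerGraph n m E)
    (d : Fin n → ZMod 2) (τ l : ℕ) (p : ℝ) :
    (avgBER G d τ l - p) ^ 2 ≤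
      1 / (G.code.card : ℝ) ^ 2 * ∑ c ∈ G.code ×ˢ G.code, (ber G d τ ![c.1, c.2] l - p) ^ 2 := by
  have hpos : (0 : ℝ) < (G.code.card : ℝ) ^ 2 := by
    have : 0 < G.code.card := Finset.card_pos.2 ⟨0, by simp [TannerGraph.code]⟩
    positivity
  have h1 : avgBER G d τ l - p =
      (∑ c ∈ G.code ×ˢ G.code, (ber G d τ ![c.1, c.2] l - p)) / (G.code.card : ℝ) ^ 2 := by
    rw [avgBER, Finset.sum_sub_distrib, Finset.sum_product, Finset.sum_const, Finset.card_product]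
    rw [nsmul_eq_mul, Nat.cast_mul, ← sq, sub_div, mul_div_cancel_left₀ _ hpos.ne',
      one_div_mul_eq_div]
  have h2 := sq_sum_le_card_mul_sum_sq (s := G.code ×ˢ G.code)
    (f := fun c => ber G d τ ![c.1, c.2] l - p)
  rw [Finset.card_product, Nat.cast_mul, ← sq] at h2
  rw [h1, div_pow, one_div_mul_eq_div, div_le_div_iff₀ (by positivity) hpos]
  nlinarith

/-- The code depends on the graph but not on the dither, so the sums over dithers and codewords can
be exchanged. For each pair of codewords the dither is then replaced by the erasure pattern through
the bijection. -/
theorem finMean_avgBER_sub_sq_le {τ : ℕ} (hτ : 1 ≤ τ) (l : ℕ) (p : ℝ) :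
    finMean (fun ω : a.Sample => (avgBER (a.graph ω.1 ω.2.1) ω.2.2 τ (l + 1) - p) ^ 2) Finset.univ
      ≤ finMean (fun ω : a.Sample => (erasedFrac τ l ω - p) ^ 2) Finset.univ := by
  refine div_le_div_of_nonneg_right ?_ (Nat.cast_nonneg _)
  simp only [Fintype.sum_prod_type]
  refine Finset.sum_le_sum fun π _ => Finset.sum_le_sum fun σ _ => ?_
  refine (Finset.sum_le_sum fun d _ => sq_avgBER_sub_le (a.graph π σ) d τ (l + 1) p).trans ?_
  have hpos : (0 : ℝ) < ((a.graph π σ).code.card : ℝ) ^ 2 := by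
    have : 0 < (a.graph π σ).code.card := Finset.card_pos.2 ⟨0, by simp [TannerGraph.code]⟩
    positivity
  rw [← Finset.mul_sum, Finset.sum_comm]
  have hc : ∀ c ∈ (a.graph π σ).code ×ˢ (a.graph π σ).code,
      ∑ d, (ber (a.graph π σ) d τ ![c.1, c.2] (l + 1) - p) ^ 2
        = ∑ e, (erasedFrac τ l (a := a) (π, σ, e) - p) ^ 2 := by
    intro c _
    simp only [ber_eq_erasedFrac]
    exact (erasurePattern_bijective hτ ![c.1, c.2]).sum_comp
      fun e => (erasedFrac τ l (a := a) (π, σ, e) - p) ^ 2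
  rw [Finset.sum_congr rfl hc, Finset.sum_const, Finset.card_product, nsmul_eq_mul, Nat.cast_mul,
    ← sq, ← mul_assoc, one_div_mul_cancel hpos.ne', one_mul]

theorem prob_lt_abs_le {ε : ℝ} (hε : 0 < ε) (X : a.Sample → ℝ) :
    a.prob {ω | ε < |X ω|} ≤ finMean (fun ω => X ω ^ 2) Finset.univ / ε ^ 2 := by
  classical
  have h1 : ({ω | ε < |X ω|} : Set a.Sample).ncard
      = (Finset.univ.filter fun ω => ε < |X ω|).card := by
    rw [← Set.ncard_coe_finset]
    congr 1
    ext ω; simp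
  rw [prob, h1, finMean, Nat.card_eq_fintype_card, Finset.card_univ, div_right_comm]
  refine div_le_div_of_nonneg_right ?_ (Nat.cast_nonneg _)
  rw [le_div_iff₀ (by positivity), ← nsmul_eq_mul]
  refine (Finset.card_nsmul_le_sum _ (fun ω => X ω ^ 2) _ fun ω hω => ?_).trans
    (Finset.sum_le_sum_of_subset_of_nonneg (Finset.filter_subset _ _) fun _ _ _ => sq_nonneg _)
  rw [← sq_abs (X ω)]
  exact pow_le_pow_left₀ hε.le (Finset.mem_filter.1 hω).2.le 2

end DegreeAssignment

/-! ### Limits of the empirical degree distributions -/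

namespace EdgeDist

variable (α : EdgeDist)

theorem nodeNorm_pos : 0 < ∑ j ∈ α.frac.support, α.frac j / j := by
  have hne : α.frac.support.Nonempty := by
    rw [Finset.nonempty_iff_ne_empty]
    intro h
    have := α.sum_eq_one
    simp [h] at this
  refine Finset.sum_pos (fun j hj => ?_) hne
  have h1 : α.frac j ≠ 0 := Finsupp.mem_support_iff.1 hj
  have h2 : j ≠ 0 := by
    rintro rfl
    exact h1 α.frac_zero
  exact div_pos (lt_of_le_of_ne (α.nonneg j) h1.symm) (by exact_mod_cast Nat.pos_of_ne_zero h2)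

theorem nodeFrac_mul (i : ℕ) :
    α.nodeFrac i * i = α.frac i / ∑ j ∈ α.frac.support, α.frac j / j := by
  rcases eq_or_ne i 0 with rfl | hi
  · simp [α.frac_zero]
  · have : (i : ℝ) ≠ 0 := by exact_mod_cast hi
    rw [nodeFrac, div_mul_eq_mul_div, div_mul_cancel₀ _ this]

theorem nodeFrac_eq_zero {i : ℕ} (hi : i ∉ α.frac.support) : α.nodeFrac i = 0 := by
  simp [nodeFrac, Finsupp.notMem_support_iff.1 hi]

theorem sum_nodeFrac_mul (φ : ℕ → ℝ) : ∑ i ∈ α.frac.support, α.nodeFrac i * (i * φ i)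
    = (∑ i ∈ α.frac.support, α.frac i * φ i) / ∑ j ∈ α.frac.support, α.frac j / j := by
  rw [Finset.sum_div]
  refine Finset.sum_congr rfl fun i _ => ?_
  rw [← mul_assoc, nodeFrac_mul]
  ring

theorem nodePoly_one : α.nodePoly 1 = 1 := by
  simp only [nodePoly, one_pow, mul_one, nodeFrac, ← Finset.sum_div]
  exact div_self α.nodeNorm_pos.ne'

end EdgeDist

section Limits

variable {α : EdgeDist} {m : ℕ → ℕ} {d : ∀ k, Fin (m k) → ℕ} {D : ℕ}

/-- Bounded degrees turn the average into a sum over at most `D + 1` degrees, in which convergence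
may be taken term by term. The limit law has no mass above `D`. -/
theorem tendsto_node_average (hD : ∀ k i, d k i ≤ D)
    (hα : ∀ i : ℕ, Tendsto
      (fun k => ((Finset.univ.filter fun v => d k v = i).card : ℝ) / (m k : ℝ))
      atTop (𝓝 (α.nodeFrac i)))
    {φ : ℕ → ℕ → ℝ} {φ' : ℕ → ℝ} (hφ : ∀ i, Tendsto (fun k => φ k i) atTop (𝓝 (φ' i))) :
    Tendsto (fun k => (∑ v, φ k (d k v)) / (m k : ℝ)) atTop
      (𝓝 (∑ i ∈ α.frac.support, α.nodeFrac i * φ' i)) := by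
  have hbig : ∀ i, D < i → α.nodeFrac i = 0 := fun i hi => by
    refine tendsto_nhds_unique (hα i) (tendsto_const_nhds.congr fun k => ?_)
    rw [Finset.filter_false_of_mem fun v _ => ((hD k v).trans_lt hi).ne]
    simp
  have hsum : ∑ i ∈ α.frac.support, α.nodeFrac i * φ' i
      = ∑ i ∈ Finset.range (D + 1), α.nodeFrac i * φ' i := by
    have h1 : ∑ i ∈ α.frac.support, α.nodeFrac i * φ' i
        = ∑ i ∈ α.frac.support ∪ Finset.range (D + 1), α.nodeFrac i * φ' i :=
      Finset.sum_subset Finset.subset_union_left fun i _ hi => by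
        rw [α.nodeFrac_eq_zero hi, zero_mul]
    rw [h1]
    refine (Finset.sum_subset Finset.subset_union_right fun i _ hi => ?_).symm
    rw [hbig i (by simpa using hi), zero_mul]
  have heq : ∀ k, (∑ v, φ k (d k v)) / (m k : ℝ) = ∑ i ∈ Finset.range (D + 1),
      ((Finset.univ.filter fun v => d k v = i).card : ℝ) / (m k : ℝ) * φ k i := fun k => by
    rw [← Finset.sum_fiberwise_of_maps_to (s := Finset.univ) (t := Finset.range (D + 1))
      (g := d k) (fun v _ => Finset.mem_range.2 (Nat.lt_succ_of_le (hD k v))), Finset.sum_div]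
    refine Finset.sum_congr rfl fun i _ => ?_
    rw [Finset.sum_congr rfl fun v hv => by rw [(Finset.mem_filter.1 hv).2], Finset.sum_const,
      nsmul_eq_mul]
    ring
  simp only [heq, hsum]
  exact tendsto_finsetSum _ fun i _ => (hα i).mul (hφ i)

theorem tendsto_average_degree (hD : ∀ k i, d k i ≤ D)
    (hα : ∀ i : ℕ, Tendsto
      (fun k => ((Finset.univ.filter fun v => d k v = i).card : ℝ) / (m k : ℝ))
      atTop (𝓝 (α.nodeFrac i))) :
    Tendsto (fun k => (Fintype.card (Σ v, Fin (d k v)) : ℝ) / (m k : ℝ)) atTop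
      (𝓝 (∑ j ∈ α.frac.support, α.frac j / j)⁻¹) := by
  have h := tendsto_node_average hD hα (φ := fun _ i => i * 1) (φ' := fun i => i * 1)
    (fun i => tendsto_const_nhds)
  rw [α.sum_nodeFrac_mul fun _ => 1] at h
  simpa [α.sum_eq_one] using h

/-- An average over half-edges is a size-biased average over nodes: the ratio of a degree-weighted
node average to the average degree. The normalizing sum of the node fractions cancels. -/
theorem tendsto_edge_average (hD : ∀ k i, d k i ≤ D)
    (hα : ∀ i : ℕ, Tendsto
      (fun k => ((Finset.univ.filter fun v => d k v = i).card : ℝ) / (m k : ℝ))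
      atTop (𝓝 (α.nodeFrac i)))
    {φ : ℕ → ℕ → ℝ} {φ' : ℕ → ℝ} (hφ : ∀ i, Tendsto (fun k => φ k i) atTop (𝓝 (φ' i))) :
    Tendsto (fun k => (∑ s : Σ v, Fin (d k v), φ k (d k s.1)) /
      (Fintype.card (Σ v, Fin (d k v)) : ℝ)) atTop (𝓝 (∑ i ∈ α.frac.support, α.frac i * φ' i)) := by
  have h1 := tendsto_node_average hD hα (φ := fun k i => i * φ k i) (φ' := fun i => i * φ' i)
    (fun i => tendsto_const_nhds.mul (hφ i))
  have hpos := α.nodeNorm_pos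
  have h := h1.div (tendsto_average_degree hD hα) (inv_ne_zero hpos.ne')
  rw [α.sum_nodeFrac_mul, div_inv_eq_mul, div_mul_cancel₀ _ hpos.ne'] at h
  refine h.congr fun k => ?_
  have hsum : ∑ s : Σ v, Fin (d k v), φ k (d k s.1) = ∑ v, d k v * φ k (d k v) := by
    rw [Fintype.sum_sigma]
    simp
  rw [Pi.div_apply, hsum]
  rcases Nat.eq_zero_or_pos (m k) with h0 | h0
  · have : IsEmpty (Fin (m k)) := by rw [h0]; infer_instance
    simp
  · have : (m k : ℝ) ≠ 0 := by exact_mod_cast h0.ne'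
    rw [div_div_div_cancel_right₀ this]

end Limits

/-- The initial value 1/2 fits the general formula because `L(1) = 1`. This is why `deY` needs no
separate MAC variable. -/
theorem deState_z (lam rho : EdgeDist) (l : ℕ) :
    (deState lam rho l).z = 1 / 2 * lam.nodePoly (deState lam rho l).y := by
  cases l with
  | zero => simp [deState, lam.nodePoly_one]
  | succ l => rfl

/-! ### Density evolution of the finite graphs in the limit -/

namespace IsLDPCSequence

variable {lam rho : EdgeDist} {n : ℕ → ℕ} {deg : ∀ k, DegreeAssignment (n k)}

theorem tendsto_vnNode (h : IsLDPCSequence lam rho n deg) {y : ℕ → ℝ} {y' : ℝ}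
    (hy : Tendsto y atTop (𝓝 y')) :
    Tendsto (fun k => (deg k).vnNode (y k)) atTop (𝓝 (lam.nodePoly y')) := by
  obtain ⟨D, hD⟩ := h.bounded
  simpa [DegreeAssignment.vnNode, EdgeDist.nodePoly] using tendsto_node_average (fun k => (hD k).1) h.vn_frac
    (φ := fun k i => y k ^ i) (fun i => hy.pow i)

theorem tendsto_vnEdge (h : IsLDPCSequence lam rho n deg) {y : ℕ → ℝ} {y' : ℝ}
    (hy : Tendsto y atTop (𝓝 y')) :
    Tendsto (fun k => (deg k).vnEdge (y k)) atTop (𝓝 (lam.edgePoly y')) := by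
  obtain ⟨D, hD⟩ := h.bounded
  exact tendsto_edge_average (fun k => (hD k).1) h.vn_frac
    (φ := fun k i => y k ^ (i - 1)) (fun i => hy.pow (i - 1))

theorem tendsto_deY (h : IsLDPCSequence lam rho n deg) (l : ℕ) :
    Tendsto (fun k => (deg k).deY l) atTop (𝓝 (deState lam rho l).y) := by
  induction l with
  | zero => exact tendsto_const_nhds
  | succ l ih =>
    obtain ⟨D, hD⟩ := h.bounded
    have hx : Tendsto (fun k => 1 / 2 * (deg k).vnNode ((deg k).deY l) *
        (deg k).vnEdge ((deg k).deY l)) atTop (𝓝 (deState lam rho (l + 1)).x) := by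
      rw [show (deState lam rho (l + 1)).x
        = (deState lam rho l).z * lam.edgePoly (deState lam rho l).y from rfl, deState_z]
      exact (tendsto_const_nhds.mul (h.tendsto_vnNode ih)).mul (h.tendsto_vnEdge ih)
    have := tendsto_edge_average (fun k => (hD k).2) h.cn_frac
      (φ := fun k i => 1 - (1 - 1 / 2 * (deg k).vnNode ((deg k).deY l) *
        (deg k).vnEdge ((deg k).deY l)) ^ (i - 1))
      (fun i => tendsto_const_nhds.sub ((tendsto_const_nhds.sub hx).pow (i - 1)))
    have hlim : ∑ i ∈ rho.frac.support,
        rho.frac i * (1 - (1 - (deState lam rho (l + 1)).x) ^ (i - 1))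
        = (deState lam rho (l + 1)).y := by
      simp only [mul_sub, mul_one, Finset.sum_sub_distrib, rho.sum_eq_one]
      rfl
    rw [hlim] at this
    exact this

theorem tendsto_deBit (h : IsLDPCSequence lam rho n deg) (l : ℕ) :
    Tendsto (fun k => (deg k).deBit l) atTop (𝓝 (deBER lam rho (l + 1))) := by
  rw [deBER, deState_z]
  exact (tendsto_const_nhds.mul (h.tendsto_vnNode (h.tendsto_deY l))).mul
    (h.tendsto_vnNode (h.tendsto_deY (l + 1)))

/-- The number of half-edges grows linearly in the blocklength, since the average degree has a
positive limit, while `D` and `M` stay fixed. The assumption on the maximal delay enters only here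
and makes the bound uniform in `τ`. -/
theorem eventually_sparse (h : IsLDPCSequence lam rho n deg) {τmax : ℕ → ℕ}
    (hτmax : Tendsto (fun N : ℕ => (τmax N : ℝ) / (N : ℝ)) atTop (𝓝 0)) {D : ℕ}
    (hD : ∀ k, (∀ i, (deg k).dv i ≤ D) ∧ ∀ j, (deg k).dc j ≤ D) (M : ℕ) {η : ℝ} (hη : 0 < η) :
    ∀ᶠ k in atTop, ∀ τ : ℕ, 1 ≤ τ → τ ≤ τmax (n k) → (deg k).Sparse τ D M η := by
  have hn : Tendsto (fun k => (n k : ℝ)) atTop atTop :=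
    tendsto_natCast_atTop_atTop.comp h.blocklength
  have h1 : Tendsto (fun k => (Fintype.card (deg k).VStub : ℝ) / n k * n k) atTop atTop :=
    (tendsto_average_degree (fun k => (hD k).1) h.vn_frac).pos_mul_atTop
      (inv_pos.2 lam.nodeNorm_pos) hn
  have h2 : Tendsto (fun k => (2 * M : ℝ) / n k + (τmax (n k) : ℝ) / n k) atTop (𝓝 (0 + 0)) :=
    (hn.const_div_atTop _).add (hτmax.comp h.blocklength)
  rw [add_zero] at h2
  filter_upwards [h1.eventually_ge_atTop ((D * M : ℝ) / η), h2.eventually_lt_const hη,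
    hn.eventually_gt_atTop 0] with k hk1 hk2 hk0 τ hτ1 hτ2
  refine ⟨hη.le, hτ1, (hD k).1, (hD k).2, ?_, ?_⟩
  · rw [div_mul_cancel₀ _ hk0.ne', div_le_iff₀ hη] at hk1
    linarith
  · rw [← add_div, div_lt_iff₀ hk0] at hk2
    have : (τ : ℝ) ≤ τmax (n k) := by exact_mod_cast hτ2
    linarith

end IsLDPCSequence

theorem theorem2 (lam rho : EdgeDist) (n : ℕ → ℕ) (deg : ∀ k, DegreeAssignment (n k))
    (hdeg : IsLDPCSequence lam rho n deg) (τmax : ℕ → ℕ)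
    (hτmax : Tendsto (fun N : ℕ => (τmax N : ℝ) / (N : ℝ)) atTop (𝓝 0))
    (l : ℕ) (hl : 1 ≤ l) (ε : ℝ) (hε : 0 < ε) :
    ∀ δ : ℝ, 0 < δ → ∀ᶠ k in atTop, ∀ τ : ℕ, 1 ≤ τ → τ ≤ τmax (n k) →
      (deg k).prob {ω | ε < |avgBER ((deg k).graph ω.1 ω.2.1) ω.2.2 τ l - deBER lam rho l|} < δ := by
  intro δ hδ
  obtain ⟨l, rfl⟩ : ∃ j, l = j + 1 := ⟨l - 1, by omega⟩
  obtain ⟨D, hD⟩ := hdeg.bounded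
  set κ := DegreeAssignment.nodeCost D l
  set p := deBER lam rho (l + 1)
  set θ := δ * ε ^ 2 with hθ
  have hθ0 : 0 < θ := by positivity
  have hκ : (0 : ℝ) < 16 * (κ + 1) := by positivity
  -- By Chebyshev's inequality a mean square below `θ` suffices. This choice keeps the correlation
  -- term `8 * κ * η` below `θ / 2`; the diagonal term and the error of the finite-degree density
  -- evolution share the other half.
  have hη : 0 < θ / (16 * (κ + 1)) := by positivity
  have hn : Tendsto (fun k => (n k : ℝ)) atTop atTop :=
    tendsto_natCast_atTop_atTop.comp hdeg.blocklength
  have hrest : Tendsto (fun k => 2 * (1 / (n k : ℝ)) + 2 * ((deg k).deBit l - p) ^ 2) atTop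
      (𝓝 (2 * 0 + 2 * (p - p) ^ 2)) :=
    ((hn.const_div_atTop 1).const_mul 2).add
      ((((hdeg.tendsto_deBit l).sub tendsto_const_nhds).pow 2).const_mul 2)
  rw [show (2 * 0 + 2 * (p - p) ^ 2 : ℝ) = 0 by ring] at hrest
  filter_upwards [hdeg.eventually_sparse hτmax hD (2 + 2 * κ) hη,
    hrest.eventually_lt_const (half_pos hθ0), hdeg.blocklength.eventually_gt_atTop 0]
    with k hk1 hk2 hk0 τ hτ1 hτ2
  have hms := DegreeAssignment.finMean_erasedFrac_sub_sq_le (hk1 τ hτ1 hτ2) l le_rfl hk0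
  have hmean : finMean (fun ω : (deg k).Sample =>
      (DegreeAssignment.erasedFrac τ l ω - p) ^ 2) Finset.univ < θ := by
    calc finMean (fun ω : (deg k).Sample => (DegreeAssignment.erasedFrac τ l ω - p) ^ 2) Finset.univ
        ≤ finMean (fun ω : (deg k).Sample =>
            2 * (DegreeAssignment.erasedFrac τ l ω - (deg k).deBit l) ^ 2 +
              2 * ((deg k).deBit l - p) ^ 2) Finset.univ := finMean_mono fun ω _ => by
          nlinarith [sq_nonneg ((DegreeAssignment.erasedFrac τ l ω - (deg k).deBit l) -
            ((deg k).deBit l - p))]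
      _ ≤ 2 * (4 * κ * (θ / (16 * (κ + 1))) + 1 / n k) + 2 * ((deg k).deBit l - p) ^ 2 := by
          rw [finMean_add, finMean_const_mul]
          exact add_le_add (mul_le_mul_of_nonneg_left hms zero_le_two)
            (finMean_const_le (by positivity) _)
      _ < θ := by
          have : 8 * κ * (θ / (16 * (κ + 1))) ≤ θ / 2 := by
            rw [mul_div_assoc', div_le_iff₀ hκ]
            nlinarith
          linarith
  refine (DegreeAssignment.prob_lt_abs_le hε _).trans_lt ?_
  rw [div_lt_iff₀ (by positivity)]
  exact (DegreeAssignment.finMean_avgBER_sub_sq_le hτ1 l p).trans_lt hmean
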